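/- For a unital $C^*$-algebra $B$ let $T(B)$ be the set of its tracial states, extended to matrices over $B$ by $\tau((b_{ij}))=\sum_i\tau(b_{ii})$, and let $B^\infty=\ell^\infty(\mathbb N,B)/c_0(B)$; elements of $B^\infty$ are written $(b_n)_n$, and $B$ is embedded in $B^\infty$ as the constant sequences. Write $P(\cdot)$ for the set of projections. The algebra $B$ has real rank zero if its invertible self-adjoint elements are dense in its self-adjoint elements. The order on projections over $B$ is determined by traces if, whenever $p,q\in P(M_m(B))$ for some $m$ satisfy $\tau(p)<\tau(q)$ for all $\tau\in T(B)$, there is $w\in M_m(B)$ with $w^*w=p$ and $ww^*\le q$. A (separable) unital $C^*$-algebra $A$ has property (SI) if the following holds for every unital $C^*$-algebra $B$ of real rank zero over which the order on projections is determined by traces, and every unital embedding $A\subset B$. Let $(e_n)_n,(f_n)_n\in P(B^\infty\cap A')$ be represented by bounded sequences of self-adjoint elements $e_n,f_n\in B$ such that 1. there is $c>0$ such that for all $p\in P(A)$ and $\varepsilon>0$ there is $N\in\mathbb N$ with $c\,\tau(p)-\varepsilon\le\tau(pf_np)$ for all $n\ge N$ and all $\tau\in T(B)$; 2. $\tau(e_n)\to0$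 uniformly in $\tau\in T(B)$. Then there is $(w_n)_n\in B^\infty\cap A'$ with $$(w_n)^*(w_n)=(e_n),\qquad (w_n)(w_n)^*\le(f_n),\qquad (w_n)^2=0\qquad\text{in }B^\infty.$$ An A$\mathbb T$-algebra is a $C^*$-algebraic inductive limit of a sequence of finite direct sums of algebras $M_k\otimes C(\mathbb T)$, with $*$-homomorphisms as connecting maps. **Proposition.** Every unital simple A$\mathbb T$-algebra of real rank zero has property (SI). -/

import Mathlib

universe u v

open Filter Topology
open scoped BoundedContinuousFunction ComplexOrder

/-- The order of a C⋆-algebra: `a ≤ b` if and only if `b - a` is positive, that is, of the form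
`x⋆ x`. It is only used for C⋆-algebras. -/
def CStarLE {R : Type*} [Ring R] [Star R] (a b : R) : Prop :=
  ∃ x : R, b - a = star x * x

/-- A unital C⋆-algebra is simple if it is nonzero and has no closed two-sided ideals besides
`0` and itself. -/
def IsSimpleCStarAlgebra (A : Type*) [CStarAlgebra A] : Prop :=
  Nontrivial A ∧ ∀ I : TwoSidedIdeal A, IsClosed (I : Set A) → I = ⊥ ∨ I = ⊤

/-- Real rank zero: the invertible self-adjoint elements are dense in the self-adjoint ones. -/
def HasRealRankZero (A : Type*) [CStarAlgebra A] : Prop :=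
  ∀ a : A, IsSelfAdjoint a → ∀ ε : ℝ, 0 < ε →
    ∃ b : A, IsSelfAdjoint b ∧ IsUnit b ∧ ‖a - b‖ < ε

/-! ### Inductive limits and AT-algebras -/

/-- The composite connecting maps `C n → C (n + k)` of an inductive sequence. -/
def connectingMap {C : ℕ → Type*} [∀ n, NonUnitalCStarAlgebra (C n)]
    (φ : ∀ n, C n →⋆ₙₐ[ℂ] C (n + 1)) (n : ℕ) : ∀ k : ℕ, C n →⋆ₙₐ[ℂ] C (n + k)
  | 0 => NonUnitalStarAlgHom.id ℂ (C n)
  | k + 1 => (φ (n + k)).comp (connectingMap φ n k)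

/-- `A`, with the canonical maps `ψ n : C n → A`, is the C⋆-algebraic inductive limit of the
sequence `(C n, φ n)`: the completion of the algebraic limit for the seminorm
`‖a‖ = lim_k ‖φ_{n, n + k} a‖`, `a ∈ C n`. The connecting maps need be neither injective nor
unital. -/
structure IsCStarInductiveLimit {C : ℕ → Type*} [∀ n, NonUnitalCStarAlgebra (C n)]
    (φ : ∀ n, C n →⋆ₙₐ[ℂ] C (n + 1)) {A : Type*} [NonUnitalCStarAlgebra A]
    (ψ : ∀ n, C n →⋆ₙₐ[ℂ] A) : Prop where
  compatible : ∀ n (a : C n), ψ (n + 1) (φ n a) = ψ n a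
  dense_range : Dense (⋃ n, Set.range (ψ n))
  norm_eq : ∀ n (a : C n),
    Tendsto (fun k => ‖connectingMap φ n k a‖) atTop (𝓝 ‖ψ n a‖)

/-- The circle algebra `⨁_{i < r} C(𝕋, M_{k i})`, which is `B ⊗ C(𝕋)` for the finite-dimensional
C⋆-algebra `B = ⨁_{i < r} M_{k i}`. -/
def CircleAlgebra {r : ℕ} (k : Fin r → ℕ) : Type :=
  ∀ i : Fin r, C(Circle, CStarMatrix (Fin (k i)) (Fin (k i)) ℂ)

noncomputable instance {r : ℕ} (k : Fin r → ℕ) : CStarAlgebra (CircleAlgebra k) :=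
  inferInstanceAs
    (CStarAlgebra (∀ i : Fin r, C(Circle, CStarMatrix (Fin (k i)) (Fin (k i)) ℂ)))

/-- An AT-algebra is the inductive limit of a sequence of circle algebras. -/
def IsATAlgebra (A : Type*) [CStarAlgebra A] : Prop :=
  ∃ (r : ℕ → ℕ) (k : ∀ n, Fin (r n) → ℕ)
    (φ : ∀ n, CircleAlgebra (k n) →⋆ₙₐ[ℂ] CircleAlgebra (k (n + 1)))
    (ψ : ∀ n, CircleAlgebra (k n) →⋆ₙₐ[ℂ] A),
    IsCStarInductiveLimit φ ψ

/-! ### Traces and comparison of projections -/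

/-- Tracial states of a unital C⋆-algebra. -/
structure TracialState (B : Type*) [CStarAlgebra B] extends B →ₗ[ℂ] ℂ where
  map_star_mul_self_nonneg : ∀ b : B, 0 ≤ toFun (star b * b)
  map_one : toFun 1 = 1
  map_mul_comm : ∀ a b : B, toFun (a * b) = toFun (b * a)

noncomputable instance {B : Type*} [CStarAlgebra B] : CoeFun (TracialState B) (fun _ => B → ℂ) :=
  ⟨fun τ => τ.toLinearMap⟩

/-- The order on projections over `B` is determined by traces: if `p`, `q` are projections in
matrices over `B` with `τ(p) < τ(q)` for every tracial state `τ` of `B` (extended to matrices by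
`τ(p) = ∑ i, τ(p i i)`), then `w⋆ w = p` and `w w⋆ ≤ q` for some matrix `w` over `B`. Any two
elements of `M_∞(B)` lie in a common `M_n(B)`. -/
def ProjectionOrderDeterminedByTraces (B : Type*) [CStarAlgebra B] : Prop :=
  ∀ (n : ℕ) (p q : Matrix (Fin n) (Fin n) B), IsStarProjection p → IsStarProjection q →
    (∀ τ : TracialState B, (τ p.trace).re < (τ q.trace).re) →
    ∃ w : Matrix (Fin n) (Fin n) B, star w * w = p ∧ CStarLE (w * star w) q

/-! ### The sequence algebra `B^∞ = ℓ^∞(ℕ, B) / c₀(B)` -/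

section SequenceAlgebra

variable (B : Type*) [CStarAlgebra B]

/-- `c₀(B)`, the ideal of null sequences in the algebra `ℓ^∞(ℕ, B)` of bounded sequences. -/
noncomputable def nullSequences : TwoSidedIdeal (ℕ →ᵇ B) :=
  TwoSidedIdeal.mk' {x | Tendsto (fun n => x n) atTop (𝓝 0)}
    (by simp)
    (fun {x y} hx hy => by
      have h := Tendsto.add hx hy
      simpa using h)
    (fun {x} hx => by
      have h := Tendsto.neg hx
      simpa using h)
    (fun {x y} hy => by
      simp only [Set.mem_ofPred_eq] at hy ⊢
      rw [tendsto_zero_iff_norm_tendsto_zero] at hy ⊢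
      have h := hy.const_mul ‖x‖
      rw [mul_zero] at h
      refine squeeze_zero (fun _ => norm_nonneg _) (fun n => ?_) h
      exact (norm_mul_le _ _).trans
        (mul_le_mul_of_nonneg_right (x.norm_coe_le_norm n) (norm_nonneg _)))
    (fun {x y} hx => by
      simp only [Set.mem_ofPred_eq] at hx ⊢
      rw [tendsto_zero_iff_norm_tendsto_zero] at hx ⊢
      have h := hx.mul_const ‖y‖
      rw [zero_mul] at h
      refine squeeze_zero (fun _ => norm_nonneg _) (fun n => ?_) h
      exact (norm_mul_le _ _).trans
        (mul_le_mul_of_nonneg_left (y.norm_coe_le_norm n) (norm_nonneg _)))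

theorem mem_nullSequences {x : ℕ →ᵇ B} :
    x ∈ nullSequences B ↔ Tendsto (fun n => x n) atTop (𝓝 0) :=
  (TwoSidedIdeal.mem_mk' _ _ _ _ _ _ x).trans Iff.rfl

/-- The quotient `B^∞ = ℓ^∞(ℕ, B) / c₀(B)`. -/
def SequenceAlgebra : Type _ := (nullSequences B).ringCon.Quotient

noncomputable instance : Ring (SequenceAlgebra B) :=
  inferInstanceAs (Ring (nullSequences B).ringCon.Quotient)

variable {B}

/-- The class in `B^∞` of a bounded sequence in `B`. -/
noncomputable def seqClass : (ℕ →ᵇ B) →+* SequenceAlgebra B := (nullSequences B).ringCon.mk'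

theorem seqClass_eq_iff {x y : ℕ →ᵇ B} :
    seqClass x = seqClass y ↔ Tendsto (fun n => x n - y n) atTop (𝓝 0) := by
  have h : seqClass x = seqClass y ↔ (nullSequences B).ringCon x y := RingCon.eq _
  rw [h, TwoSidedIdeal.rel_iff, mem_nullSequences]
  simp

/-- The involution of `B^∞` is induced by the one of `B`, applied termwise. -/
noncomputable instance : Star (SequenceAlgebra B) where
  star := Quotient.map' (fun x : ℕ →ᵇ B => star x) (fun x y h => by
    have h' : Tendsto (fun n => x n - y n) atTop (𝓝 0) :=
      seqClass_eq_iff.1 ((RingCon.eq _).2 h)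
    refine (RingCon.eq _).1 (seqClass_eq_iff.2 ?_)
    have h2 := h'.star
    simpa using h2)

theorem seqClass_star (x : ℕ →ᵇ B) : seqClass (star x) = star (seqClass x) := rfl

/-- The relative commutant `B^∞ ∩ A'` for `ι : A → B`, where `B` sits in `B^∞` as the constant
sequences. -/
noncomputable def relativeCommutant {A : Type*} [CStarAlgebra A] (ι : A →⋆ₐ[ℂ] B) :
    Subring (SequenceAlgebra B) :=
  Subring.centralizer
    (Set.range fun a : A => seqClass (BoundedContinuousFunction.const ℕ (ι a)))

end SequenceAlgebra

/-! ### Property (SI) -/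

/-- Property (SI) for a unital C⋆-algebra `A`. The test algebra `B` is arbitrary (in particular it
need be neither simple nor separable). The smallness of `(e n)` and the largeness of `(f n)` are
both uniform over the tracial states of `B`: `(e n)` is infinitesimally small in the sequence
algebra. The universe `v` of the test algebras is arbitrary. -/
def HasPropertySI (A : Type u) [CStarAlgebra A] : Prop :=
  ∀ (B : Type v) [CStarAlgebra B], HasRealRankZero B → ProjectionOrderDeterminedByTraces B →
  ∀ ι : A →⋆ₐ[ℂ] B, Function.Injective ι →
  ∀ e f : ℕ →ᵇ B,
    (∀ n, IsSelfAdjoint (e n)) → (∀ n, IsSelfAdjoint (f n)) →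
    IsStarProjection (seqClass e) → seqClass e ∈ relativeCommutant ι →
    IsStarProjection (seqClass f) → seqClass f ∈ relativeCommutant ι →
    (∃ c : ℝ, 0 < c ∧ ∀ p : A, IsStarProjection p → ∀ ε : ℝ, 0 < ε →
      ∃ N : ℕ, ∀ n, N ≤ n → ∀ τ : TracialState B,
        c * (τ (ι p)).re - ε ≤ (τ (ι p * f n * ι p)).re) →
    (∀ ε : ℝ, 0 < ε → ∃ N : ℕ, ∀ n, N ≤ n → ∀ τ : TracialState B, ‖τ (e n)‖ < ε) →
    ∃ w : SequenceAlgebra B, w ∈ relativeCommutant ι ∧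
      star w * w = seqClass e ∧ CStarLE (w * star w) (seqClass f) ∧ w ^ 2 = 0

-- The element `w` is assembled from partial isometries that carry `e` under `f` and under
-- projections of `A` on which elements of a circle algebra look like scalars.
--
-- Let `ψ` map a circle algebra to `A`. A function `a` is, up to `ε`, a sum of `ρ s ⊗ a s` for a
-- partition of unity `ρ` on the closed set of points that `ψ` sees. Expanding each matrix `a s` in
-- matrix units gives `ψ a ≈ ∑ ω a κ κ' • (star (c κ) * c κ')`. Since `A` has real rank zero, there
-- are nonzero projections `p s` in `A` concentrated near `s`, and compressing `ψ (star (d κ) * a *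
-- d κ')` by them returns the scalar `ω a κ κ'`, or `0` for two different points. This is
-- `HasExcision`, proved in `hasExcision_of_matrixUnits`.
--
-- By simplicity the traces of `ι (p s)` are bounded below uniformly
-- (`IsSimpleCStarAlgebra.exists_le_trace`), so `ι (p s) * f n * ι (p s)` keeps a definite trace
-- while that of `e n` tends to `0`. Real rank zero of `B` lets one discard a projection of small
-- trace so that the rest is almost orthogonal to `e n`; comparison by traces then moves `e n` into
-- this rest. The resulting sequences `S s` satisfy `star (S s) * ψ (star (d κ) * a * d κ') * S t =
-- ω a κ κ' • e` in `B^∞`, and `w = ∑ ψ (d κ) * S (ν κ) * c κ` satisfies `star w * ψ a * w ≈ ψ a *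
-- e`.
--
-- A diagonal choice makes `star w * a * w = a * e` exact for `a` in a countable set containing a
-- dense sequence and the products `star a * a` of its members. Expanding the square of the
-- commutator of `w` and `a` then shows that it vanishes, and `w = w * e` with `e * w = 0` gives `w
-- ^ 2 = 0` (`SequenceAlgebra.exists_nilpotent_of_intertwiner`).

attribute [local instance] CStarAlgebra.spectralOrder CStarAlgebra.spectralOrderedRing

/-! ### Projections in C⋆-algebras of real rank zero -/

section CStarLemmas

variable {B : Type*} [CStarAlgebra B]

theorem conjugate_le_of_isSelfAdjoint {a b p : B} (hp : IsSelfAdjoint p) (h : a ≤ b) :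
    p * a * p ≤ p * b * p := by
  have := star_left_conjugate_le_conjugate h p
  rwa [hp.star_eq] at this

theorem IsSelfAdjoint.le_smul_one_of_norm_le {a : B} (ha : IsSelfAdjoint a) {r : ℝ}
    (h : ‖a‖ ≤ r) : a ≤ r • (1 : B) := by
  have h1 := ha.le_algebraMap_norm_self
  rw [Algebra.algebraMap_eq_smul_one] at h1
  exact h1.trans (smul_le_smul_of_nonneg_right h zero_le_one)

theorem norm_sq_le_of_star_mul_self_le {x : B} {r : ℝ} (hr : 0 ≤ r)
    (h : star x * x ≤ r • (1 : B)) : ‖x‖ ^ 2 ≤ r := by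
  have h1 : ‖star x * x‖ ≤ r := by
    rw [CStarAlgebra.norm_le_iff_le_algebraMap _ hr (star_mul_self_nonneg x),
      Algebra.algebraMap_eq_smul_one]
    exact h
  rwa [CStarRing.norm_star_mul_self, ← sq] at h1

/-- The spectral projection of an invertible self-adjoint element on the positive half-line. -/
theorem exists_positive_spectral_projection {c : B} (hc : IsSelfAdjoint c) (hu : IsUnit c) :
    ∃ r : B, IsStarProjection r ∧ 0 ≤ c * r ∧ c * (1 - r) ≤ 0 ∧
      ∀ y, Commute y c → Commute y r := by
  have h0 : (0 : ℝ) ∉ spectrum ℝ c := spectrum.zero_notMem ℝ hu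
  -- The step function jumps only at `0`, which invertibility keeps out of the spectrum.
  have hcont : ContinuousOn (fun x : ℝ => if 0 < x then (1 : ℝ) else 0) (spectrum ℝ c) := by
    intro x hx
    have hx0 : x ≠ 0 := fun h => h0 (h ▸ hx)
    apply ContinuousAt.continuousWithinAt
    rcases lt_or_gt_of_ne hx0 with h | h
    · refine (continuousAt_const (y := (0 : ℝ))).congr ?_
      filter_upwards [gt_mem_nhds h] with y hy
      simp [not_lt.2 hy.le]
    · refine (continuousAt_const (y := (1 : ℝ))).congr ?_
      filter_upwards [lt_mem_nhds h] with y hy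
      simp [hy]
  have hcr : c * cfc (fun x : ℝ => if 0 < x then (1 : ℝ) else 0) c =
      cfc (fun x : ℝ => x * (if 0 < x then (1 : ℝ) else 0)) c := by
    rw [cfc_mul (fun x : ℝ => x) _ c (by fun_prop) hcont, cfc_id' ℝ c]
  refine ⟨cfc (fun x : ℝ => if 0 < x then (1 : ℝ) else 0) c, ⟨?_, ?_⟩, ?_, ?_, ?_⟩
  · rw [IsIdempotentElem, ← cfc_mul _ _ c hcont hcont]
    exact cfc_congr fun x _ => by simp
  · exact cfc_predicate _ c
  · rw [hcr]
    refine cfc_nonneg fun x _ => ?_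
    split_ifs with h
    · simpa using h.le
    · simp
  · rw [mul_sub, mul_one, hcr]
    rw [sub_nonpos]
    conv_lhs => rw [← cfc_id' ℝ c]
    refine cfc_mono (fun x _ => ?_) (by fun_prop) (continuousOn_id.mul hcont)
    split_ifs with h
    · simp
    · simpa using h
  · intro y hy
    exact (hy.symm.cfc_real _ ).symm

/-- The spectrum of `a` lies where `|x * x - x| ≤ δ < 1 / 4`, so it misses `1 / 2` and the step
function there is continuous on it. -/
theorem exists_projection_near {a : B} (ha : IsSelfAdjoint a) {δ : ℝ} (hδ : δ < 1 / 4)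
    (h : ‖a * a - a‖ ≤ δ) : ∃ p : B, IsStarProjection p ∧ ‖p - a‖ ≤ 2 * δ := by
  have hspec : ∀ x ∈ spectrum ℝ a, |x * x - x| ≤ δ := by
    intro x hx
    have h2 : a * a - a = cfc (fun x : ℝ => x * x - x) a := by
      rw [cfc_sub _ _ a, cfc_mul _ _ a, cfc_id' ℝ a]
    rw [h2] at h
    exact (norm_apply_le_norm_cfc (fun x : ℝ => x * x - x) a hx).trans h
  have hcont : ContinuousOn (fun x : ℝ => if 1 / 2 < x then (1 : ℝ) else 0) (spectrum ℝ a) := by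
    intro x hx
    have hx0 : x ≠ 1 / 2 := by
      rintro rfl
      have := hspec _ hx
      rw [abs_le] at this
      linarith [this.1]
    apply ContinuousAt.continuousWithinAt
    rcases lt_or_gt_of_ne hx0 with h | h
    · refine (continuousAt_const (y := (0 : ℝ))).congr ?_
      filter_upwards [gt_mem_nhds h] with y hy
      rw [if_neg (not_lt.2 hy.le)]
    · refine (continuousAt_const (y := (1 : ℝ))).congr ?_
      filter_upwards [lt_mem_nhds h] with y hy
      rw [if_pos hy]
  have hδ0 : 0 ≤ δ := (norm_nonneg _).trans h
  refine ⟨cfc (fun x : ℝ => if 1 / 2 < x then (1 : ℝ) else 0) a, ⟨?_, ?_⟩, ?_⟩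
  · rw [IsIdempotentElem, ← cfc_mul _ _ a hcont hcont]
    exact cfc_congr fun x _ => by simp
  · exact cfc_predicate _ a
  · nth_rewrite 2 [← cfc_id' ℝ a]
    rw [← cfc_sub _ _ a hcont (by fun_prop)]
    refine norm_cfc_le (by linarith) fun x hx => ?_
    have := hspec x hx
    rw [abs_le] at this
    rw [Real.norm_eq_abs, abs_le]
    split_ifs with h <;> constructor <;> nlinarith

/-- In a C⋆-algebra of real rank zero, every corner has real rank zero. -/
theorem HasRealRankZero.exists_commute_isUnit_near (hB : HasRealRankZero B) {p a : B}
    (hp : IsStarProjection p) (ha : IsSelfAdjoint a) (hap : a * p = a) {ε : ℝ} (hε : 0 < ε) :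
    ∃ c : B, IsSelfAdjoint c ∧ Commute p c ∧ IsUnit c ∧ ‖c - (a + (1 - p))‖ < ε := by
  have hpa : p * a = a := by
    have := congrArg star hap
    rwa [star_mul, ha.star_eq, hp.isSelfAdjoint.star_eq] at this
  have hpp : p * p = p := hp.isIdempotentElem
  have hsp : star p = p := hp.isSelfAdjoint
  have hp1 : ‖p‖ ≤ 1 := hp.norm_le
  have hq1 : ‖1 - p‖ ≤ 1 := hp.one_sub.norm_le
  set a' := a + (1 - p) with ha'
  have hsa' : IsSelfAdjoint a' := ha.add hp.one_sub.isSelfAdjoint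
  set R : ℝ := ‖a'‖ + 1 with hR
  have hR0 : 0 < R := by positivity
  -- The first bound makes the corner `D` below invertible with inverse of norm at most `2`; the
  -- second absorbs the errors `η`, `2 * η * R` (twice) and `4 * η ^ 2 * R` of the last step.
  set η : ℝ := min (1 / 2) (ε / (1 + 8 * R)) with hη
  have hη0 : 0 < η := by positivity
  have hη2 : η ≤ 1 / 2 := min_le_left _ _
  have hηε : η * (1 + 8 * R) ≤ ε := by
    rw [← le_div_iff₀ (by positivity)]; exact min_le_right _ _
  obtain ⟨b, hb, hbu, hab⟩ := hB a' hsa' η hη0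
  have hbR : ‖b‖ ≤ R := by
    have : ‖b‖ ≤ ‖a'‖ + ‖a' - b‖ := by
      have := norm_sub_le a' (a' - b)
      simpa using this
    linarith
  have hnorm3 : ∀ x z : B, ‖x‖ ≤ 1 → ‖z‖ ≤ 1 → ‖x * (b - a') * z‖ ≤ η := by
    intro x z hx hz
    calc ‖x * (b - a') * z‖ ≤ ‖x‖ * ‖b - a'‖ * ‖z‖ := norm_mul₃_le
      _ ≤ 1 * η * 1 := by
        gcongr
        rw [norm_sub_rev]; exact hab.le
      _ = η := by ring
  set x := p * b * (1 - p) with hx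
  have hxn : ‖x‖ ≤ η := by
    have : x = p * (b - a') * (1 - p) := by
      have h0 : p * a' * (1 - p) = 0 := by
        simp only [ha', mul_add, mul_sub, add_mul, sub_mul, mul_one, hpa, hap, hpp]
        noncomm_ring
      rw [mul_sub p, sub_mul _ _ (1 - p), h0, sub_zero]
    rw [this]; exact hnorm3 _ _ hp1 hq1
  set D := p + (1 - p) * b * (1 - p) with hD
  have hDn : ‖1 - D‖ ≤ η := by
    have : 1 - D = -((1 - p) * (b - a') * (1 - p)) := by
      have h0 : (1 - p) * a' * (1 - p) = 1 - p := by
        simp only [ha', mul_add, mul_sub, add_mul, sub_mul, mul_one, one_mul, hpa, hap, hpp]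
        noncomm_ring
      rw [mul_sub (1 - p), sub_mul _ _ (1 - p), h0, hD]; noncomm_ring
    rw [this, norm_neg]; exact hnorm3 _ _ hq1 hq1
  have hDu : IsUnit D := by
    have := isUnit_one_sub_of_norm_lt_one (x := 1 - D) (by linarith)
    simpa using this
  obtain ⟨y, hy⟩ := hDu
  set Y : B := ↑y⁻¹ with hYdef
  have hDY : D * Y = 1 := by rw [← hy]; exact y.mul_inv
  have hYD : Y * D = 1 := by rw [← hy]; exact y.inv_mul
  have hDp : Commute p D := by
    rw [commute_iff_eq, hD]
    simp only [mul_add, add_mul, ← mul_assoc, hpp, mul_sub, sub_mul, mul_one, one_mul]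
    simp only [mul_assoc, hpp]; noncomm_ring
  have hYp : p * Y = Y * p := by
    have h1 : Y * (D * p) * Y = Y * (p * D) * Y := by rw [hDp.eq]
    rw [← mul_assoc, hYD, one_mul, mul_assoc, mul_assoc, hDY, mul_one] at h1
    exact h1
  have hsD : star D = D := by
    simp [hD, star_mul, hsp, hb.star_eq, mul_assoc]
  have hsY : star Y = Y := by
    have h1 : star Y * D = 1 := by
      have := congrArg star hDY
      rwa [star_mul, hsD, star_one] at this
    calc star Y = star Y * (D * Y) := by rw [hDY, mul_one]
      _ = Y := by rw [← mul_assoc, h1, one_mul]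
  have hYn : ‖Y‖ ≤ 2 := by
    have h1 : Y = 1 + (1 - D) * Y := by rw [sub_mul, hDY]; noncomm_ring
    have h2 : ‖Y‖ ≤ 1 + η * ‖Y‖ := by
      calc ‖Y‖ = ‖1 + (1 - D) * Y‖ := by rw [← h1]
        _ ≤ ‖(1 : B)‖ + ‖(1 - D) * Y‖ := norm_add_le _ _
        _ ≤ 1 + η * ‖Y‖ := by
          gcongr
          · exact (IsStarProjection.one B).norm_le
          · exact (norm_mul_le _ _).trans (by gcongr)
    nlinarith [norm_nonneg Y]
  -- Gaussian elimination in block form: subtracting `N` times the lower row clears the off-diagonal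
  -- corner `x` of `b`. As `N * N = 0`, the factor `1 - N` is invertible, so `c` stays invertible
  -- while becoming block diagonal for `p`.
  set N := x * Y with hN
  have hNn : ‖N‖ ≤ 2 * η := by
    calc ‖N‖ ≤ ‖x‖ * ‖Y‖ := norm_mul_le _ _
      _ ≤ η * 2 := by gcongr
      _ = 2 * η := by ring
  have hNN : N * N = 0 := by
    have : (1 - p) * Y * p = 0 := by
      rw [mul_assoc, ← hYp, ← mul_assoc, sub_mul, hpp, one_mul, sub_self, zero_mul]
    calc N * N = p * b * ((1 - p) * Y * p) * b * (1 - p) * Y := by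
          simp only [hN, hx, mul_assoc]
      _ = 0 := by rw [this]; simp
  have hLu : IsUnit (1 - N) := by
    refine ⟨⟨1 - N, 1 + N, ?_, ?_⟩, rfl⟩ <;>
    · simp only [sub_mul, mul_add, add_mul, mul_sub, one_mul, mul_one, hNN]; abel
  set c := (1 - N) * b * star (1 - N) with hc
  have hcsa : IsSelfAdjoint c := hb.conjugate (1 - N)
  have hpN : (1 - p) * N = 0 := by
    simp only [hN, hx, ← mul_assoc, sub_mul, one_mul, hpp, sub_self, zero_mul]
  have hsN : star (1 - N) * (1 - p) = 1 - p := by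
    have : star N * (1 - p) = 0 := by
      have := congrArg star hpN
      simpa [star_mul, hsp] using this
    rw [star_sub, sub_mul, this, star_one, one_mul, sub_zero]
  have hpc : p * c * (1 - p) = 0 := by
    have h1 : p * c * (1 - p) = p * b * (1 - p) - p * N * b * (1 - p) := by
      rw [hc]
      rw [mul_assoc, mul_assoc ((1 - N) * b), hsN]
      noncomm_ring
    have h2 : p * N * b * (1 - p) = p * b * (1 - p) * Y * b * (1 - p) := by
      simp only [hN, hx, ← mul_assoc, hpp]
    have h3 : (1 - p) * Y * b * (1 - p) = Y * D * (1 - p) := by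
      have : (1 - p) * Y = Y * (1 - p) := by rw [sub_mul, mul_sub, hYp, one_mul, mul_one]
      rw [this, hD, mul_add, add_mul, mul_assoc Y p, mul_sub p, hpp, mul_one, sub_self, mul_zero,
        zero_add]
      have : (1 - p) * (1 - p) = 1 - p := hp.one_sub.isIdempotentElem
      simp only [mul_assoc, this]
    rw [h1, h2, mul_assoc (p * b), mul_assoc (p * b), mul_assoc (p * b), h3, hYD, one_mul, sub_self]
  have hcp : (1 - p) * c * p = 0 := by
    have := congrArg star hpc
    simpa [star_mul, hsp, hcsa.star_eq, mul_assoc] using this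
  refine ⟨c, hcsa, ?_, ?_, ?_⟩
  · rw [commute_iff_eq]
    have h1 : p * c = p * c * p := by
      rw [mul_sub, mul_one, sub_eq_zero] at hpc; exact hpc
    have h2 : c * p = p * c * p := by
      rw [sub_mul, one_mul, sub_mul, sub_eq_zero] at hcp; exact hcp
    rw [h1, ← h2]
  · exact (hLu.mul hbu).mul hLu.star
  · have h1 : c - a' = (b - a') - N * b - b * star N + N * b * star N := by
      rw [hc, star_sub, star_one]; noncomm_ring
    have h2 : ‖N * b‖ ≤ 2 * η * R := (norm_mul_le _ _).trans (by gcongr)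
    have h3 : ‖b * star N‖ ≤ R * (2 * η) := (norm_mul_le _ _).trans (by rw [norm_star]; gcongr)
    have h4 : ‖N * b * star N‖ ≤ (2 * η * R) * (2 * η) :=
      (norm_mul_le _ _).trans (by rw [norm_star]; gcongr)
    have h5 : ‖b - a'‖ < η := by rwa [norm_sub_rev]
    have h6 : ‖c - a'‖ ≤ ‖b - a'‖ + ‖N * b‖ + ‖b * star N‖ + ‖N * b * star N‖ := by
      rw [h1]
      refine (norm_add_le _ _).trans ?_
      gcongr
      refine (norm_sub_le _ _).trans ?_
      gcongr
      exact norm_sub_le _ _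
    nlinarith [mul_pos hη0 hR0]

/-- In a C⋆-algebra of real rank zero, positive elements of norm one are nearly units for some
nonzero projection. -/
theorem HasRealRankZero.exists_projection_of_norm_eq_one (hB : HasRealRankZero B) {g : B}
    (hg : 0 ≤ g) (hg1 : ‖g‖ = 1) {η : ℝ} (hη : 0 < η) :
    ∃ p : B, IsStarProjection p ∧ p ≠ 0 ∧ ‖p - g * p‖ ≤ η := by
  have hgsa : IsSelfAdjoint g := .of_nonneg hg
  have hgle : g ≤ 1 := by
    rw [← CStarAlgebra.norm_le_one_iff_of_nonneg g]; exact hg1.le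
  set δ : ℝ := min (1 / 2) (η ^ 2 / 2) with hδ
  have hδ0 : 0 < δ := by positivity
  have hδη : 2 * δ ≤ η ^ 2 := by
    have : δ ≤ η ^ 2 / 2 := min_le_right _ _
    linarith
  have hδ1 : δ ≤ 1 / 2 := min_le_left _ _
  -- The positive part of `b` approximates the spectral projection of `g` above `1 - δ`. Were it
  -- zero, `g` would lie below `1 - δ / 2`, against norm one.
  obtain ⟨b, hb, hbu, hab⟩ := hB (g - (1 - δ) • (1 : B))
    (hgsa.sub (by simp [IsSelfAdjoint])) (δ / 2) (by positivity)
  obtain ⟨p, hp, hbp, hbp', hcomm⟩ := exists_positive_spectral_projection hb hbu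
  have hpp : p * p = p := hp.isIdempotentElem
  have hsp : star p = p := hp.isSelfAdjoint
  have hdiff : IsSelfAdjoint (g - (1 - δ) • (1 : B) - b) :=
    (hgsa.sub (by simp [IsSelfAdjoint])).sub hb
  refine ⟨p, hp, ?_, ?_⟩
  · rintro rfl
    have hb0 : b ≤ 0 := by simpa using hbp'
    have h1 := hdiff.le_smul_one_of_norm_le hab.le
    have h2 : g ≤ (1 - δ / 2) • (1 : B) := by
      calc g = (g - (1 - δ) • (1 : B) - b) + b + (1 - δ) • (1 : B) := by abel
        _ ≤ (δ / 2) • (1 : B) + 0 + (1 - δ) • (1 : B) := by gcongr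
        _ = (1 - δ / 2) • (1 : B) := by rw [add_zero, ← add_smul]; congr 1; ring
    have h3 : ‖g‖ ≤ 1 - δ / 2 := by
      rw [CStarAlgebra.norm_le_iff_le_algebraMap _ (by linarith) hg,
        Algebra.algebraMap_eq_smul_one]
      exact h2
    linarith
  · have h1 := hdiff.neg.le_smul_one_of_norm_le (r := δ / 2) (by rw [norm_neg]; exact hab.le)
    have hbp2 : 0 ≤ p * b * p := by
      have : p * b * p = b * p := by rw [← (hcomm b (Commute.refl b)).eq, mul_assoc, hpp]
      rwa [this]
    have h2 : (1 - g) ≤ (3 * δ / 2) • (1 : B) - b := by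
      have : 1 - g = -(g - (1 - δ) • (1 : B) - b) + δ • (1 : B) - b := by
        rw [sub_smul, one_smul]; abel
      rw [this]
      have : (3 * δ / 2) • (1 : B) = (δ / 2) • (1 : B) + δ • (1 : B) := by
        rw [← add_smul]; congr 1; ring
      rw [this]
      gcongr
    have h3 : p * (1 - g) * p ≤ (3 * δ / 2) • (1 : B) := by
      calc p * (1 - g) * p ≤ p * ((3 * δ / 2) • (1 : B) - b) * p :=
            conjugate_le_of_isSelfAdjoint hsp h2
        _ = (3 * δ / 2) • p - p * b * p := by
            rw [mul_sub, sub_mul, mul_smul_comm, smul_mul_assoc, mul_one, hpp]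
        _ ≤ (3 * δ / 2) • p := sub_le_self _ hbp2
        _ ≤ (3 * δ / 2) • (1 : B) := smul_le_smul_of_nonneg_left hp.le_one (by positivity)
    have h4 : (1 - g) * (1 - g) ≤ 1 - g := by
      have h5 : 0 ≤ 1 - g := sub_nonneg.2 hgle
      have := CStarAlgebra.pow_antitone h5 (sub_le_self _ hg) (show 1 ≤ 2 by norm_num)
      simpa [sq] using this
    have h6 : star (p - g * p) * (p - g * p) ≤ (η ^ 2) • (1 : B) := by
      calc star (p - g * p) * (p - g * p) = p * ((1 - g) * (1 - g)) * p := by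
            rw [star_sub, star_mul, hsp, hgsa.star_eq]; noncomm_ring
        _ ≤ p * (1 - g) * p := conjugate_le_of_isSelfAdjoint hsp h4
        _ ≤ (3 * δ / 2) • (1 : B) := h3
        _ ≤ (η ^ 2) • (1 : B) := smul_le_smul_of_nonneg_right (by linarith) zero_le_one
    have h7 := norm_sq_le_of_star_mul_self_le (by positivity) h6
    exact abs_le_of_sq_le_sq' h7 hη.le |>.2

/-- In a C⋆-algebra of real rank zero, any projection `p` dominates a projection `q` nearly
orthogonal to a given projection `e`, with `p - q` small if `e` is. -/
theorem HasRealRankZero.exists_projection_nearly_orthogonal (hB : HasRealRankZero B) {p e : B}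
    (hp : IsStarProjection p) (he : IsStarProjection e) {t : ℝ} (ht : 0 < t) :
    ∃ q : B, IsStarProjection q ∧ p * q = q ∧ ‖e * q‖ ^ 2 ≤ 2 * t ∧
      IsStarProjection (p - q) ∧ (t / 2) • (p - q) ≤ (p - q) * e * (p - q) := by
  have hpp : p * p = p := hp.isIdempotentElem
  have hsp : star p = p := hp.isSelfAdjoint
  have hee : e * e = e := he.isIdempotentElem
  have hse : star e = e := he.isSelfAdjoint
  have hsa : IsSelfAdjoint (p * e * p - t • p) := by
    refine IsSelfAdjoint.sub ?_ ?_
    · have := he.isSelfAdjoint.conjugate p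
      rwa [hsp] at this
    · exact (IsSelfAdjoint.all t).smul hp.isSelfAdjoint
  -- Perturbing `p * e * p - t • p` inside the corner opens a spectral gap: the negative part `p *
  -- (1 - r)` serves as `q`, and on the positive part `p * r` the compression of `e` is at least `t
  -- / 2`.
  obtain ⟨c, hc, hpc, hcu, hcn⟩ := hB.exists_commute_isUnit_near hp hsa
    (by simp only [sub_mul, mul_assoc, hpp, smul_mul_assoc]) (half_pos ht)
  obtain ⟨r, hr, hcr, hcr', hcomm⟩ := exists_positive_spectral_projection hc hcu
  have hrr : r * r = r := hr.isIdempotentElem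
  have hsr : star r = r := hr.isSelfAdjoint
  have hpr : p * r = r * p := (hcomm p hpc).eq
  have hcr2 : c * r = r * c := (hcomm c (Commute.refl c)).eq
  have hproj : ∀ z : B, IsStarProjection z → p * z = z * p → IsStarProjection (p * z) :=
    fun z hz h => ⟨by
      rw [IsIdempotentElem, mul_assoc, ← mul_assoc z, ← h, mul_assoc p z, hz.isIdempotentElem.eq,
        ← mul_assoc, hpp], by
      rw [IsSelfAdjoint, star_mul, hsp, hz.isSelfAdjoint.star_eq, h]⟩
  have hpr' : p * (1 - r) = (1 - r) * p := by rw [mul_sub, sub_mul, hpr]; simp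
  have hq := hproj (1 - r) hr.one_sub hpr'
  have hpq : p - p * (1 - r) = p * r := by noncomm_ring
  have hq' : IsStarProjection (p - p * (1 - r)) := by rw [hpq]; exact hproj r hr hpr
  set a' := p * e * p - t • p + (1 - p) with ha'
  have hsa' : IsSelfAdjoint a' := hsa.add hp.one_sub.isSelfAdjoint
  have key : ∀ z : B, p * z = z → z * p = z → z * z = z →
      z * a' * z = z * e * z - t • z := by
    intro z h1 h2 h3
    have h4 : z * (p * e * p) * z = z * e * z := by
      calc z * (p * e * p) * z = (z * p) * e * (p * z) := by simp only [mul_assoc]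
        _ = _ := by rw [h1, h2]
    have h5 : z * (1 - p) = 0 := by rw [mul_sub, h2, mul_one, sub_self]
    rw [ha', mul_add, add_mul, h5, zero_mul, add_zero, mul_sub, sub_mul, h4, mul_smul_comm,
      smul_mul_assoc, h2, h3]
  refine ⟨p * (1 - r), hq, by rw [← mul_assoc, hpp], ?_, hq', ?_⟩
  · set q := p * (1 - r)
    have hqq : q * q = q := hq.isIdempotentElem
    have hsq : star q = q := hq.isSelfAdjoint
    have hpq1 : p * q = q := by rw [← mul_assoc, hpp]
    have hpq2 : q * p = q := by
      have := congrArg star hpq1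
      rwa [star_mul, hsp, hsq] at this
    have h1 := (hsa'.sub hc).le_smul_one_of_norm_le (r := t / 2)
      (by rw [norm_sub_rev]; exact hcn.le)
    have h2 : q * c * q ≤ 0 := by
      have h3 := conjugate_le_of_isSelfAdjoint (p := p) hsp hcr'
      have h4 : p * (c * (1 - r)) * p = q * c * q := by
        have hc1 : c * (1 - r) = (1 - r) * c := by rw [mul_sub, sub_mul, hcr2]; simp
        have hr1 : (1 - r) * (1 - r) = 1 - r := hr.one_sub.isIdempotentElem
        calc p * (c * (1 - r)) * p = p * (c * ((1 - r) * (1 - r))) * p := by rw [hr1]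
          _ = p * ((c * (1 - r)) * (1 - r)) * p := by simp only [mul_assoc]
          _ = (p * (1 - r)) * c * ((1 - r) * p) := by rw [hc1]; simp only [mul_assoc]
          _ = q * c * q := by rw [← hpr']
      rw [h4] at h3
      simpa using h3
    have h5 : q * e * q - t • q ≤ (t / 2) • q := by
      rw [← key q hpq1 hpq2 hqq]
      calc q * a' * q = q * (a' - c) * q + q * c * q := by noncomm_ring
        _ ≤ q * ((t / 2) • (1 : B)) * q + 0 :=
          add_le_add (conjugate_le_of_isSelfAdjoint hsq h1) h2
        _ = (t / 2) • q := by rw [add_zero, mul_smul_comm, smul_mul_assoc, mul_one, hqq]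
    have h6 : star (e * q) * (e * q) ≤ (2 * t) • (1 : B) := by
      calc star (e * q) * (e * q) = q * (e * e) * q := by
            rw [star_mul, hsq, hse]; simp only [mul_assoc]
        _ = q * e * q := by rw [hee]
        _ ≤ (t / 2) • q + t • q := by rwa [← sub_le_iff_le_add]
        _ = (t / 2 + t) • q := by rw [add_smul]
        _ ≤ (t / 2 + t) • (1 : B) := smul_le_smul_of_nonneg_left hq.le_one (by positivity)
        _ ≤ (2 * t) • (1 : B) := smul_le_smul_of_nonneg_right (by linarith) zero_le_one
    exact norm_sq_le_of_star_mul_self_le (by positivity) h6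
  · rw [hpq] at hq' ⊢
    set q := p * r
    have hqq : q * q = q := hq'.isIdempotentElem
    have hsq : star q = q := hq'.isSelfAdjoint
    have hpq1 : p * q = q := by rw [← mul_assoc, hpp]
    have hpq2 : q * p = q := by
      have := congrArg star hpq1
      rwa [star_mul, hsp, hsq] at this
    have h1 := (hc.sub hsa').le_smul_one_of_norm_le (r := t / 2) hcn.le
    have h2 : 0 ≤ q * c * q := by
      have h3 := conjugate_le_of_isSelfAdjoint (p := p) hsp hcr
      have h4 : p * (c * r) * p = q * c * q := by
        calc p * (c * r) * p = p * (c * (r * r)) * p := by rw [hrr]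
          _ = p * ((c * r) * r) * p := by simp only [mul_assoc]
          _ = (p * r) * c * (r * p) := by rw [hcr2]; simp only [mul_assoc]
          _ = q * c * q := by rw [← hpr]
      rw [h4] at h3
      simpa using h3
    have h5 : -((t / 2) • q) ≤ q * e * q - t • q := by
      rw [← key q hpq1 hpq2 hqq, neg_le]
      calc -(q * a' * q) = q * (c - a') * q - q * c * q := by noncomm_ring
        _ ≤ q * (c - a') * q := sub_le_self _ h2
        _ ≤ q * ((t / 2) • (1 : B)) * q := conjugate_le_of_isSelfAdjoint hsq h1
        _ = (t / 2) • q := by rw [mul_smul_comm, smul_mul_assoc, mul_one, hqq]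
    have h6 : (t / 2) • q = -((t / 2) • q) + t • q := by
      rw [← neg_smul, ← add_smul]; congr 1; ring
    rw [h6]
    rwa [← le_sub_iff_add_le]

end CStarLemmas

/-! ### Tracial states and comparison of projections -/

namespace TracialState

variable {B : Type*} [CStarAlgebra B] (τ : TracialState B)

theorem re_nonneg {a : B} (ha : 0 ≤ a) : 0 ≤ (τ a).re := by
  obtain ⟨y, rfl⟩ := CStarAlgebra.nonneg_iff_eq_star_mul_self.1 ha
  have := (Complex.le_def.1 (τ.map_star_mul_self_nonneg y)).1
  simpa using this

theorem re_mono {a b : B} (h : a ≤ b) : (τ a).re ≤ (τ b).re := by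
  have := τ.re_nonneg (sub_nonneg.2 h)
  rw [map_sub, Complex.sub_re] at this
  linarith

theorem re_smul (r : ℝ) (a : B) : (τ (r • a)).re = r * (τ a).re := by
  rw [← Complex.coe_smul, map_smul, smul_eq_mul, Complex.re_ofReal_mul]

theorem re_one : (τ 1).re = 1 := by
  have : τ 1 = 1 := τ.map_one
  rw [this, Complex.one_re]

theorem mul_comm (a b : B) : τ (a * b) = τ (b * a) := τ.map_mul_comm a b

theorem re_le_norm {a : B} (ha : IsSelfAdjoint a) : (τ a).re ≤ ‖a‖ := by
  have := τ.re_mono (ha.le_smul_one_of_norm_le le_rfl)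
  rwa [re_smul, re_one, mul_one] at this

theorem re_star_mul_self_add_le (a b : B) :
    (τ (star (a + b) * (a + b))).re ≤ 2 * (τ (star a * a)).re + 2 * (τ (star b * b)).re := by
  have h1 : star (a + b) * (a + b) ≤ (2 : ℝ) • (star a * a) + (2 : ℝ) • (star b * b) := by
    rw [← sub_nonneg]
    have : (2 : ℝ) • (star a * a) + (2 : ℝ) • (star b * b) - star (a + b) * (a + b)
        = star (a - b) * (a - b) := by
      rw [two_smul, two_smul, star_add, star_sub]; noncomm_ring
    rw [this]; exact star_mul_self_nonneg _
  have := τ.re_mono h1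
  rwa [map_add, Complex.add_re, re_smul, re_smul] at this

theorem re_star_mul_self_mul_left_le (x a : B) :
    (τ (star (x * a) * (x * a))).re ≤ ‖x‖ ^ 2 * (τ (star a * a)).re := by
  have h1 : star a * (star x * x) * a ≤ ‖star x * x‖ • (star a * a) :=
    CStarAlgebra.star_left_conjugate_le_norm_smul (IsSelfAdjoint.star_mul_self x)
  have h2 := τ.re_mono h1
  rw [re_smul, CStarRing.norm_star_mul_self, ← sq] at h2
  rwa [star_mul, show star a * star x * (x * a) = star a * (star x * x) * a by
    simp only [mul_assoc]]

theorem re_star_mul_self_mul_right_le (a x : B) :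
    (τ (star (a * x) * (a * x))).re ≤ ‖x‖ ^ 2 * (τ (star a * a)).re := by
  rw [τ.mul_comm, τ.mul_comm (star a) a]
  have h := τ.re_star_mul_self_mul_left_le (star x) (star a)
  rwa [norm_star, star_mul, star_star, star_star, ← star_mul] at h

end TracialState

/-- The elements whose trace-square is controlled by the trace of `p`, up to every `ε`, form a
closed two-sided ideal containing `p`. By simplicity it contains `1`, and `1 ≤ 1 / 2 + C * τ p` is
the lower bound. The slack `ε` is what makes the ideal closed. -/
theorem IsSimpleCStarAlgebra.exists_le_trace {A B : Type*} [CStarAlgebra A] [CStarAlgebra B]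
    (hA : IsSimpleCStarAlgebra A) (ι : A →⋆ₐ[ℂ] B) {p : A} (hp : IsStarProjection p)
    (hp0 : p ≠ 0) : ∃ δ : ℝ, 0 < δ ∧ ∀ τ : TracialState B, δ ≤ (τ (ι p)).re := by
  have hpos : ∀ τ : TracialState B, 0 ≤ (τ (ι p)).re := fun τ =>
    τ.re_nonneg (hp.map ι).nonneg
  have hsq : ∀ (τ : TracialState B) (b : B), 0 ≤ (τ (star b * b)).re := fun τ b =>
    τ.re_nonneg (star_mul_self_nonneg b)
  let S : Set A := {a | ∀ ε : ℝ, 0 < ε → ∃ C : ℝ, 0 ≤ C ∧ ∀ τ : TracialState B,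
    (τ (star (ι a) * ι a)).re ≤ ε + C * (τ (ι p)).re}
  have hscale : ∀ (a b : A) (K : ℝ), 0 ≤ K → a ∈ S →
      (∀ τ : TracialState B, (τ (star (ι b) * ι b)).re ≤ K * (τ (star (ι a) * ι a)).re) →
      b ∈ S := by
    intro a b K hK ha hab ε hε
    obtain ⟨C, hC, h⟩ := ha (ε / (K + 1)) (by positivity)
    refine ⟨K * C, by positivity, fun τ => (hab τ).trans ?_⟩
    have h1 := mul_le_mul_of_nonneg_left (h τ) hK
    have h2 : K * (ε / (K + 1)) ≤ ε := by
      rw [mul_div_assoc', div_le_iff₀ (by positivity)]; nlinarith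
    linarith [mul_assoc K C (τ (ι p)).re]
  let I : TwoSidedIdeal A := TwoSidedIdeal.mk' S
    (fun ε hε => ⟨0, le_rfl, fun τ => by simpa using hε.le⟩)
    (fun {a b} ha hb ε hε => by
      obtain ⟨C, hC, h⟩ := ha (ε / 4) (by positivity)
      obtain ⟨C', hC', h'⟩ := hb (ε / 4) (by positivity)
      refine ⟨2 * C + 2 * C', by positivity, fun τ => ?_⟩
      rw [map_add]
      linarith [τ.re_star_mul_self_add_le (ι a) (ι b), h τ, h' τ])
    (fun {a} ha ε hε => by simpa using ha ε hε)
    (fun {x a} ha => hscale a (x * a) (‖ι x‖ ^ 2) (by positivity) ha fun τ => by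
      rw [map_mul ι]; exact τ.re_star_mul_self_mul_left_le _ _)
    (fun {a x} ha => hscale a (a * x) (‖ι x‖ ^ 2) (by positivity) ha fun τ => by
      rw [map_mul ι]; exact τ.re_star_mul_self_mul_right_le _ _)
  have hI : (I : Set A) = S := TwoSidedIdeal.coe_mk' _ _ _ _ _ _
  have hclosed : IsClosed (I : Set A) := by
    rw [hI]
    refine isClosed_of_closure_subset fun b hb ε hε => ?_
    obtain ⟨a, ha, hab⟩ := Metric.mem_closure_iff.1 hb (min 1 (ε / 4)) (by positivity)
    rw [dist_eq_norm] at hab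
    obtain ⟨C, hC, h⟩ := ha (ε / 4) (by positivity)
    refine ⟨2 * C, by positivity, fun τ => ?_⟩
    have h1 := τ.re_star_mul_self_add_le (ι (b - a)) (ι a)
    rw [← map_add, sub_add_cancel] at h1
    have h2 := τ.re_le_norm (IsSelfAdjoint.star_mul_self (ι (b - a)))
    rw [CStarRing.norm_star_mul_self] at h2
    have h3 : ‖ι (b - a)‖ ≤ ‖b - a‖ := NonUnitalStarAlgHom.norm_apply_le ι _
    have h4 : ‖ι (b - a)‖ ≤ 1 := h3.trans (hab.le.trans (min_le_left _ _))
    have h5 : ‖ι (b - a)‖ ≤ ε / 4 := h3.trans (hab.le.trans (min_le_right _ _))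
    nlinarith [h τ, norm_nonneg (ι (b - a))]
  have hpI : p ∈ I := by
    have : p ∈ S := fun ε hε => ⟨1, zero_le_one, fun τ => by
      rw [(hp.map ι).isSelfAdjoint.star_eq, (hp.map ι).isIdempotentElem.eq]; linarith⟩
    rwa [← hI] at this
  have htop : I = ⊤ := by
    rcases hA.2 I hclosed with h | h
    · rw [h, TwoSidedIdeal.mem_bot] at hpI
      exact absurd hpI hp0
    · exact h
  have h1 : (1 : A) ∈ S := by
    rw [← hI, htop]; trivial
  obtain ⟨C, hC, h⟩ := h1 (1 / 2) (by norm_num)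
  refine ⟨1 / (2 * (C + 1)), by positivity, fun τ => ?_⟩
  have := h τ
  rw [map_one, star_one, mul_one, τ.re_one] at this
  rw [div_le_iff₀ (by positivity)]
  nlinarith [hpos τ]

/-- Matrices of size one suffice. The order relation becomes `q * w = w` because compressing `w *
star w ≤ q` by `1 - q` forces `(1 - q) * w = 0`. -/
theorem ProjectionOrderDeterminedByTraces.exists_partial_isometry {B : Type*} [CStarAlgebra B]
    (hB : ProjectionOrderDeterminedByTraces B) {p q : B} (hp : IsStarProjection p)
    (hq : IsStarProjection q) (h : ∀ τ : TracialState B, (τ p).re < (τ q).re) :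
    ∃ w : B, star w * w = p ∧ q * w = w := by
  have hproj : ∀ r : B, IsStarProjection r →
      IsStarProjection (Matrix.diagonal fun _ : Fin 1 => r) := fun r hr => by
    refine ⟨?_, ?_⟩
    · rw [IsIdempotentElem, Matrix.diagonal_mul_diagonal, hr.isIdempotentElem.eq]
    · rw [IsSelfAdjoint, Matrix.star_eq_conjTranspose, Matrix.diagonal_conjTranspose]
      congr 1
      funext i
      exact hr.isSelfAdjoint
  obtain ⟨w, hw, y, hy⟩ := hB 1 _ _ (hproj p hp) (hproj q hq) (by simpa using h)
  have h1 := congrFun (congrFun hw 0) 0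
  have h2 := congrFun (congrFun hy 0) 0
  simp only [Matrix.mul_apply, Matrix.star_apply, Matrix.sub_apply, Matrix.diagonal_apply_eq,
    Finset.univ_unique, Fin.default_eq_zero, Finset.sum_singleton, Fin.isValue] at h1 h2
  set v := w 0 0
  set x := y 0 0
  refine ⟨v, h1, ?_⟩
  have hqq : q * q = q := hq.isIdempotentElem
  have hsq : star (1 - q) = 1 - q := hq.one_sub.isSelfAdjoint
  have h3 : (1 - q) * (v * star v) * (1 - q) ≤ 0 := by
    have : (1 - q) * (v * star v) * (1 - q) = -(star (x * (1 - q)) * (x * (1 - q))) := by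
      have h4 : v * star v = q - star x * x := by rw [← h2]; abel
      have h5 : (1 - q) * q = 0 := by rw [sub_mul, hqq, one_mul, sub_self]
      rw [h4, star_mul, hsq, mul_sub (1 - q) q, h5, zero_sub, neg_mul]
      simp only [mul_assoc]
    rw [this, neg_nonpos]
    exact star_mul_self_nonneg _
  have h4 : (1 - q) * (v * star v) * (1 - q) = (v - q * v) * star (v - q * v) := by
    rw [show v - q * v = (1 - q) * v by rw [sub_mul, one_mul], star_mul, hsq]
    simp only [mul_assoc]
  rw [h4] at h3
  have h5 := le_antisymm h3 (mul_star_self_nonneg _)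
  rw [CStarRing.mul_star_self_eq_zero_iff] at h5
  exact (sub_eq_zero.1 h5).symm

/-- Infinitesimally small projections `e n` are, up to small errors, subequivalent to the part of
the large projections `f n` under `p` and orthogonal to `e n`. -/
theorem IsSimpleCStarAlgebra.eventually_exists_partial_isometry {A B : Type*} [CStarAlgebra A]
    [CStarAlgebra B] (hA : IsSimpleCStarAlgebra A) (hB : HasRealRankZero B)
    (hT : ProjectionOrderDeterminedByTraces B) (ι : A →⋆ₐ[ℂ] B) {p : A}
    (hp : IsStarProjection p) (hp0 : p ≠ 0) (e f : ℕ →ᵇ B)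
    (he : ∀ n, IsSelfAdjoint (e n)) (hf : ∀ n, IsSelfAdjoint (f n))
    (hee : Tendsto (fun n => e n * e n - e n) atTop (𝓝 0))
    (hff : Tendsto (fun n => f n * f n - f n) atTop (𝓝 0))
    (hpf : Tendsto (fun n => ι p * f n - f n * ι p) atTop (𝓝 0))
    {c : ℝ} (hc : 0 < c)
    (hlarge : ∀ ε : ℝ, 0 < ε → ∃ N : ℕ, ∀ n, N ≤ n → ∀ τ : TracialState B,
        c * (τ (ι p)).re - ε ≤ (τ (ι p * f n * ι p)).re)
    (hsmall : ∀ ε : ℝ, 0 < ε → ∃ N : ℕ, ∀ n, N ≤ n → ∀ τ : TracialState B, ‖τ (e n)‖ < ε)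
    {η : ℝ} (hη : 0 < η) :
    ∀ᶠ n in atTop, ∃ s : B, ‖s‖ ≤ 1 ∧ ‖star s * s - e n‖ ≤ η ∧ ‖ι p * s - s‖ ≤ η ∧
      ‖f n * s - s‖ ≤ η ∧ ‖e n * s‖ ≤ η := by
  obtain ⟨δ, hδ, hδτ⟩ := hA.exists_le_trace ι hp hp0
  set P₀ := ι p with hP₀
  have hP : IsStarProjection P₀ := hp.map ι
  have hPP : P₀ * P₀ = P₀ := hP.isIdempotentElem
  have hsP : star P₀ = P₀ := hP.isSelfAdjoint
  have hP1 : ‖P₀‖ ≤ 1 := hP.norm_le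
  set F : ℝ := ‖f‖
  have hF : ∀ n, ‖f n‖ ≤ F := f.norm_coe_le_norm
  have hF0 : 0 ≤ F := norm_nonneg f
  set κ : ℕ → ℝ := fun n => ‖f n * f n - f n‖ + F * ‖P₀ * f n - f n * P₀‖ with hκ
  set α : ℕ → ℝ := fun n => ‖e n * e n - e n‖ with hα
  have hκ0 : Tendsto κ atTop (𝓝 0) := by
    have := hff.norm.add (hpf.norm.const_mul F)
    simpa using this
  have hα0 : Tendsto α atTop (𝓝 0) := by simpa using hee.norm
  -- This `t` turns the near-orthogonality bound `2 * t` into `‖E * q‖ ≤ η / 2`.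
  set t : ℝ := η ^ 2 / 8 with ht
  have ht0 : 0 < t := by positivity
  -- Passing from `P` to `q` costs trace at most `2 / t` times that of `E`. Since `P` has trace at
  -- least `c * δ / 2`, it is enough that `(1 + 2 / t) * τ E` stay below that, and `σ` leaves a
  -- factor of two.
  set σ : ℝ := c * δ / (4 * (1 + 2 / t)) with hσ
  have hσ0 : 0 < σ := by positivity
  have hσt : σ * (1 + 2 / t) = c * δ / 4 := by rw [hσ]; field_simp
  obtain ⟨N₁, hN₁⟩ := hlarge (c * δ / 4) (by positivity)
  obtain ⟨N₂, hN₂⟩ := hsmall (σ / 2) (by positivity)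
  filter_upwards [eventually_ge_atTop N₁, eventually_ge_atTop N₂,
    hκ0.eventually_lt_const (show (0 : ℝ) < min (1 / 8) (min (c * δ / 16) (η / (2 * F + 3)))
      by positivity),
    hα0.eventually_lt_const (show (0 : ℝ) < min (1 / 8) (min (σ / 4) (η / 4)) by positivity)]
    with n h1 h2 h3 h4
  rw [lt_min_iff, lt_min_iff] at h3 h4
  obtain ⟨h3a, h3b, h3c⟩ := h3
  obtain ⟨h4a, h4b, h4c⟩ := h4
  rw [lt_div_iff₀ (by positivity)] at h3c
  have hκn : 0 ≤ κ n := by positivity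
  have hFκ : 0 ≤ F * κ n := by positivity
  set g := P₀ * f n * P₀ with hg
  have hgsa : IsSelfAdjoint g := by
    have := (hf n).conjugate P₀
    rwa [hsP] at this
  have hbound : ∀ x y : B, ‖x‖ ≤ 1 → ‖y‖ ≤ 1 → ∀ z : B, ‖x * z * y‖ ≤ ‖z‖ := fun x y hx hy z =>
    calc ‖x * z * y‖ ≤ ‖x‖ * ‖z‖ * ‖y‖ := norm_mul₃_le
      _ ≤ 1 * ‖z‖ * 1 := by gcongr
      _ = ‖z‖ := by ring
  have hκ1 : ‖g * g - g‖ ≤ κ n := by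
    have : g * g - g = P₀ * (f n * f n - f n) * P₀
        + P₀ * (f n * (P₀ * f n - f n * P₀)) * P₀ := by
      have h5 : g * g = P₀ * f n * (P₀ * P₀) * f n * P₀ := by simp only [hg, mul_assoc]
      rw [h5, hPP, hg, mul_assoc P₀ (f n * _) P₀, mul_assoc (f n) _ P₀, sub_mul _ _ P₀,
        mul_assoc (f n) P₀ P₀, hPP]
      noncomm_ring
    rw [this]
    refine (norm_add_le _ _).trans (add_le_add (hbound _ _ hP1 hP1 _)
      ((hbound _ _ hP1 hP1 _).trans ((norm_mul_le _ _).trans ?_)))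
    gcongr
    exact hF n
  have hκ2 : ‖f n * g - g‖ ≤ κ n := by
    have : f n * g - g = P₀ * (f n * f n - f n) * P₀
        - (P₀ * f n - f n * P₀) * f n * P₀ := by
      rw [hg]; noncomm_ring
    rw [this]
    refine (norm_sub_le _ _).trans (add_le_add (hbound _ _ hP1 hP1 _) ?_)
    calc ‖(P₀ * f n - f n * P₀) * f n * P₀‖ ≤ ‖P₀ * f n - f n * P₀‖ * ‖f n‖ * ‖P₀‖ := norm_mul₃_le
      _ ≤ ‖P₀ * f n - f n * P₀‖ * F * 1 := by
        gcongr
        exact hF n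
      _ = _ := by ring
  -- The cut-down `g` is nearly idempotent because `f n` nearly commutes with `P₀`; `P` and `E` are
  -- honest projections near `g` and `e n`.
  obtain ⟨P, hPproj, hPg⟩ := exists_projection_near hgsa (by linarith) hκ1
  obtain ⟨E, hE, hEe⟩ := exists_projection_near (he n) (δ := α n) (by linarith) le_rfl
  obtain ⟨q, hq, hPq, hEq, hPqproj, hle⟩ :=
    hB.exists_projection_nearly_orthogonal hPproj hE ht0
  have hEE : E * E = E := hE.isIdempotentElem
  have hsE : star E = E := hE.isSelfAdjoint
  have htrace : ∀ τ : TracialState B, (τ E).re < (τ q).re := by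
    intro τ
    have hEτ : (τ E).re < σ := by
      have h5 := τ.re_le_norm (hE.isSelfAdjoint.sub (he n))
      have h6 := (Complex.re_le_norm _).trans_lt (hN₂ n h2 τ)
      rw [map_sub, Complex.sub_re] at h5
      linarith
    have hPτ : c * δ / 2 ≤ (τ P).re := by
      have h5 := τ.re_le_norm (hgsa.sub hPproj.isSelfAdjoint)
      rw [map_sub, Complex.sub_re, norm_sub_rev] at h5
      have h6 := hN₁ n h1 τ
      have h7 := mul_le_mul_of_nonneg_left (hδτ τ) hc.le
      linarith
    have h5 : t / 2 * (τ (P - q)).re ≤ (τ E).re := by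
      have h6 := τ.re_mono hle
      rw [τ.re_smul] at h6
      have h7 : τ ((P - q) * E * (P - q)) = τ (E * (P - q) * E) := by
        rw [τ.mul_comm, ← mul_assoc, hPqproj.isIdempotentElem.eq, mul_assoc, τ.mul_comm E,
          mul_assoc, hEE]
      rw [h7] at h6
      have h8 : E * (P - q) * E ≤ E := by
        have := conjugate_le_of_isSelfAdjoint hE.isSelfAdjoint hPqproj.le_one
        rwa [mul_one, hEE] at this
      exact h6.trans (τ.re_mono h8)
    have h9 : (τ (P - q)).re ≤ 2 / t * (τ E).re := by
      rw [div_mul_eq_mul_div, le_div_iff₀ ht0]; linarith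
    rw [map_sub, Complex.sub_re] at h9
    have h10 : (τ E).re * (1 + 2 / t) ≤ σ * (1 + 2 / t) := by gcongr
    have h11 : 0 < c * δ := by positivity
    rw [hσt] at h10
    linarith
  obtain ⟨s, hs, hqs⟩ := hT.exists_partial_isometry hE hq htrace
  have hs1 : ‖s‖ ≤ 1 := by
    have h5 : ‖s‖ * ‖s‖ ≤ 1 := by
      rw [← CStarRing.norm_star_mul_self, hs]; exact hE.norm_le
    nlinarith [norm_nonneg s]
  have hPs : P * s = s := by rw [← hqs, ← mul_assoc, hPq]
  have hmul : ∀ z : B, ‖z * s‖ ≤ ‖z‖ := fun z =>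
    (norm_mul_le _ _).trans (mul_le_of_le_one_right (norm_nonneg _) hs1)
  refine ⟨s, hs1, ?_, ?_, ?_, ?_⟩
  · rw [hs]; linarith
  · have h5 : P₀ * s - s = (-(1 - P₀) * (P - g) * 1) * s := by
      have : (1 - P₀) * g = 0 := by
        rw [hg, ← mul_assoc, ← mul_assoc, sub_mul, one_mul, hPP, sub_self, zero_mul, zero_mul]
      rw [mul_one, mul_sub, neg_mul _ g, this, neg_zero, sub_zero, mul_assoc, hPs]; noncomm_ring
    rw [h5]
    refine (hmul _).trans ((hbound _ _ ?_ ?_ _).trans ?_)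
    · rw [norm_neg]; exact hP.one_sub.norm_le
    · exact (IsStarProjection.one B).norm_le
    · nlinarith [norm_nonneg (P - g)]
  · have h5 : f n * s - s = (f n * (P - g) + (f n * g - g) - (P - g)) * s := by
      have : f n * (P - g) + (f n * g - g) - (P - g) = f n * P - P := by noncomm_ring
      rw [this, sub_mul, mul_assoc, hPs]
    rw [h5]
    refine (hmul _).trans ?_
    have h6 : ‖f n * (P - g)‖ ≤ F * (2 * κ n) :=
      (norm_mul_le _ _).trans (by gcongr; exact hF n)
    calc _ ≤ ‖f n * (P - g)‖ + ‖f n * g - g‖ + ‖P - g‖ :=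
          (norm_sub_le _ _).trans (add_le_add (norm_add_le _ _) le_rfl)
      _ ≤ F * (2 * κ n) + κ n + 2 * κ n := by gcongr
      _ ≤ η := by linarith
  · have h5 : e n * s = (e n - E) * s + (E * q) * s := by
      rw [mul_assoc E, hqs]; noncomm_ring
    have h6 : ‖E * q‖ ≤ η / 2 := by
      refine abs_le_of_sq_le_sq' (hEq.trans (by rw [ht]; linarith)) (by positivity) |>.2
    rw [h5]
    refine (norm_add_le _ _).trans ((add_le_add (hmul _) (hmul _)).trans ?_)
    rw [norm_sub_rev]
    linarith

/-! ### Excision of point evaluations -/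

/-- Up to `ε` on `G`, the homomorphism `ψ` factors through the matrices `ω a`, which are in turn
approximately compressions `p (d κ)⋆ a (d κ') p'` to nonzero projections. -/
def HasExcision {C A : Type*} [CStarAlgebra C] [CStarAlgebra A] (ψ : C →⋆ₙₐ[ℂ] A)
    (G : Finset C) (ε : ℝ) : Prop :=
  ∃ (M K : Type) (_ : Fintype M) (_ : Fintype K) (ν : K → M) (c : K → A) (d : K → C)
    (ω : C → K → K → ℂ),
    (∀ a ∈ G, ‖∑ κ, ∑ κ', ω a κ κ' • (star (c κ) * c κ') - ψ a‖ ≤ ε) ∧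
    (∀ a κ κ', ν κ ≠ ν κ' → ω a κ κ' = 0) ∧
    ∀ η : ℝ, 0 < η → ∃ p : M → A, (∀ m, IsStarProjection (p m) ∧ p m ≠ 0) ∧
      ∀ a ∈ G, ∀ κ κ',
        ‖p (ν κ) * ψ (star (d κ) * a * d κ') * p (ν κ') - ω a κ κ' • p (ν κ)‖ ≤ η

/-- If `g` and `g'` act almost as units on `p` and `p'`, inserting them replaces a compression by
the projections with one by `g` and `g'`, which can be computed in the circle algebra. -/
theorem norm_compression_le {A : Type*} [NormedRing A] {p p' g g' z : A} {θ : ℝ}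
    (hp : ‖p‖ ≤ 1) (hp' : ‖p'‖ ≤ 1) (hg : ‖g‖ ≤ 1) (hpg : ‖p - p * g‖ ≤ θ)
    (hpg' : ‖p' - g' * p'‖ ≤ θ) : ‖p * z * p'‖ ≤ ‖g * z * g'‖ + 2 * θ * ‖z‖ := by
  have hθ : 0 ≤ θ := (norm_nonneg _).trans hpg
  have h : p * z * p' = p * (g * z * g') * p' + (p - p * g) * z * p'
      + (p * g) * z * (p' - g' * p') := by noncomm_ring
  have h1 : ‖p * (g * z * g') * p'‖ ≤ 1 * ‖g * z * g'‖ * 1 := norm_mul₃_le.trans (by gcongr)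
  have h2 : ‖(p - p * g) * z * p'‖ ≤ θ * ‖z‖ * 1 := norm_mul₃_le.trans (by gcongr)
  have h3 : ‖(p * g) * z * (p' - g' * p')‖ ≤ (1 * 1) * ‖z‖ * θ :=
    norm_mul₃_le.trans (by gcongr; exact (norm_mul_le _ _).trans (by gcongr))
  rw [h]
  refine (norm_add₃_le).trans ?_
  linarith

section Block

variable {X : Type} [MetricSpace X] {M : Type*} [CStarAlgebra M]

/-- The elementary tensor `h ⊗ m` in `C(X) ⊗ M = C(X, M)`. -/
noncomputable def elementaryTensor (h : C(X, ℂ)) (m : M) : C(X, M) :=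
  ⟨fun x => h x • m, by fun_prop⟩

@[simp] theorem elementaryTensor_apply (h : C(X, ℂ)) (m : M) (x : X) :
    elementaryTensor h m x = h x • m := rfl

theorem elementaryTensor_mul (h h' : C(X, ℂ)) (m m' : M) :
    elementaryTensor h m * elementaryTensor h' m' = elementaryTensor (h * h') (m * m') := by
  ext x
  simp [smul_smul, mul_comm]

theorem star_elementaryTensor (h : C(X, ℂ)) (m : M) :
    star (elementaryTensor h m) = elementaryTensor (star h) (star m) := by
  ext x
  simp

theorem continuous_elementaryTensor (m : M) :
    Continuous fun h : C(X, ℂ) => elementaryTensor h m :=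
  ContinuousMap.continuous_postcomp (⟨fun z : ℂ => z • m, by fun_prop⟩ : C(ℂ, M))

theorem exists_pos_lt_dist (S : Finset X) :
    ∃ δ : ℝ, 0 < δ ∧ ∀ s ∈ S, ∀ t ∈ S, s ≠ t → 2 * δ < dist s t := by
  have h : ∀ᶠ δ : ℝ in 𝓝[>] 0, ∀ s ∈ S, ∀ t ∈ S, s ≠ t → 2 * δ < dist s t := by
    rw [Filter.eventually_all_finset]
    intro s _
    rw [Filter.eventually_all_finset]
    intro t _
    by_cases hst : s = t
    · exact Eventually.of_forall fun _ h => absurd hst h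
    · have : Tendsto (fun δ : ℝ => 2 * δ) (𝓝[>] 0) (𝓝 (2 * 0)) :=
        (continuous_const.mul continuous_id).tendsto' _ _ rfl |>.mono_left nhdsWithin_le_nhds
      rw [mul_zero] at this
      filter_upwards [this.eventually_lt_const (dist_pos.2 hst)] with δ hδ _ using hδ
  obtain ⟨δ, h1, h2⟩ := (h.and self_mem_nhdsWithin).exists
  exact ⟨δ, h2, h1⟩

/-- A bump function at `s` together with a larger one. -/
theorem exists_bump (s : X) {δ : ℝ} (hδ : 0 < δ) :
    ∃ b b' : C(X, ℂ), star b = b ∧ b s = 1 ∧ b' * b = b ∧ (∀ x, ‖b' x‖ ≤ 1) ∧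
      (∀ x, δ ≤ dist x s → b' x = 0) ∧ ∀ x, δ ≤ dist x s → b x = 0 := by
  refine ⟨⟨fun x => ((max 0 (1 - 2 * dist x s / δ) : ℝ) : ℂ), by fun_prop⟩,
    ⟨fun x => ((min 1 (max 0 (2 - 2 * dist x s / δ)) : ℝ) : ℂ), by fun_prop⟩,
    ?_, ?_, ?_, ?_, ?_, ?_⟩
  · ext x; simp
  · simp
  · ext x
    simp only [ContinuousMap.mul_apply, ContinuousMap.coe_mk]
    rw [← Complex.ofReal_mul]
    congr 1
    rcases le_total (2 * dist x s / δ) 1 with h | h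
    · rw [min_eq_left, one_mul]
      exact le_max_of_le_right (by linarith)
    · rw [max_eq_left (by linarith : 1 - 2 * dist x s / δ ≤ 0), mul_zero]
  · intro x
    simp only [ContinuousMap.coe_mk]
    rw [Complex.norm_real, Real.norm_eq_abs, abs_of_nonneg]
    · exact min_le_left _ _
    · positivity
  · intro x hx
    simp only [ContinuousMap.coe_mk]
    have : 1 ≤ dist x s / δ := by rwa [le_div_iff₀ hδ, one_mul]
    rw [max_eq_left (by rw [mul_div_assoc]; linarith)]
    simp
  · intro x hx
    simp only [ContinuousMap.coe_mk]
    have : 1 ≤ dist x s / δ := by rwa [le_div_iff₀ hδ, one_mul]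
    rw [max_eq_left (by rw [mul_div_assoc]; linarith)]
    simp

variable [CompactSpace X]

/-- The closed ideal of the scalar functions `h` with `ψ (h ⊗ m) = 0`, for an idempotent `m`. -/
noncomputable def scalarKernel {A : Type*} [CStarAlgebra A] (ψ : C(X, M) →⋆ₙₐ[ℂ] A) {m : M}
    (hm : m * m = m) : Ideal C(X, ℂ) where
  carrier := {h | ψ (elementaryTensor h m) = 0}
  add_mem' {a b} ha hb := by
    have : elementaryTensor (a + b) m = elementaryTensor a m + elementaryTensor b m := by
      ext x; simp [add_smul]
    simp only [Set.mem_ofPred_eq] at ha hb ⊢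
    rw [this, map_add, ha, hb, add_zero]
  zero_mem' := by
    have : elementaryTensor (0 : C(X, ℂ)) m = 0 := by ext x; simp
    simp only [Set.mem_ofPred_eq, this, map_zero]
  smul_mem' a b hb := by
    simp only [Set.mem_ofPred_eq] at hb ⊢
    rw [smul_eq_mul, ← hm, ← elementaryTensor_mul, map_mul, hb, mul_zero]

theorem isClosed_scalarKernel {A : Type*} [CStarAlgebra A] (ψ : C(X, M) →⋆ₙₐ[ℂ] A) {m : M}
    (hm : m * m = m) : IsClosed (scalarKernel ψ hm : Set C(X, ℂ)) :=
  isClosed_singleton.preimage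
    ((NonUnitalStarAlgHom.instContinuousLinearMapClassComplex.map_continuous ψ).comp
      (continuous_elementaryTensor (X := X) m))
    (t := {(0 : A)})

theorem exists_dist_lt_imp_norm_sub_le (G : Finset C(X, M)) {ε : ℝ} (hε : 0 < ε) :
    ∃ δ : ℝ, 0 < δ ∧ ∀ a ∈ G, ∀ x y : X, dist x y < δ → ‖a x - a y‖ ≤ ε := by
  have h : ∀ᶠ z in uniformity X, ∀ a ∈ G, dist (a z.1) (a z.2) < ε := by
    rw [Filter.eventually_all_finset]
    intro a _
    have := CompactSpace.uniformContinuous_of_continuous a.continuous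
    exact this (Metric.dist_mem_uniformity hε)
  obtain ⟨δ, hδ, h⟩ := Metric.mem_uniformity_dist.1 h
  refine ⟨δ, hδ, fun a ha x y hxy => ?_⟩
  rw [← dist_eq_norm]
  exact (h hxy a ha).le

variable {A : Type*} [CStarAlgebra A]

/-- The points are taken in the closed set `Y` attached to the kernel of `ψ` on scalar functions, so
that a bump at such a point has nonzero image and real rank zero yields a projection under it. The
matrix units `E i o` move every entry of `a s` to the corner at `o`, where it is a scalar. -/
theorem hasExcision_of_matrixUnits (hA : HasRealRankZero A) (ψ : C(X, M) →⋆ₙₐ[ℂ] A)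
    {ι : Type} [Fintype ι] [DecidableEq ι] (o : ι) (E : ι → ι → M) (coord : M → ι → ι → ℂ)
    (hmul : ∀ i j k, E i j * E j k = E i k) (hmul0 : ∀ i j j' k, j ≠ j' → E i j * E j' k = 0)
    (hstar : ∀ i j, star (E i j) = E j i) (hsum : ∑ i, E i i = 1)
    (hcoord : ∀ m, ∑ i, ∑ j, coord m i j • E i j = m) (G : Finset C(X, M)) {ε : ℝ}
    (hε : 0 < ε) : HasExcision ψ G ε := by
  classical
  have hEoo : E o o * E o o = E o o := hmul o o o
  have hproj : ∀ i, IsStarProjection (E i i) := fun i => ⟨hmul i i i, hstar i i⟩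
  have hEn : ∀ i j, ‖E i j‖ ≤ 1 := by
    intro i j
    have h1 : ‖E i j‖ * ‖E i j‖ ≤ 1 := by
      rw [← CStarRing.norm_star_mul_self, hstar, hmul]; exact (hproj j).norm_le
    nlinarith [norm_nonneg (E i j)]
  have hcompress : ∀ m i j, E o i * m * E j o = coord m i j • E o o := by
    intro m i j
    nth_rewrite 1 [← hcoord m]
    rw [Finset.mul_sum, Finset.sum_mul, Finset.sum_eq_single i]
    · rw [Finset.mul_sum, Finset.sum_mul, Finset.sum_eq_single j]
      · rw [mul_smul_comm, smul_mul_assoc, hmul, hmul]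
      · intro l _ hl
        rw [mul_smul_comm, smul_mul_assoc, hmul, hmul0 _ _ _ _ hl, smul_zero]
      · simp
    · intro l _ hl
      rw [Finset.mul_sum, Finset.sum_mul]
      refine Finset.sum_eq_zero fun l' _ => ?_
      rw [mul_smul_comm, smul_mul_assoc, hmul0 _ _ _ _ hl.symm, zero_mul, smul_zero]
    · simp
  set I := scalarKernel ψ hEoo with hI
  set Y : Set X := (ContinuousMap.setOfIdeal I)ᶜ with hY
  have hYclosed : IsClosed Y := (ContinuousMap.setOfIdeal_open I).isClosed_compl
  -- A closed ideal of `C(X)` consists of the functions vanishing off its open set. Killing `h` in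
  -- the corner at `o` kills it in all of `C(X, M)`, since `1 = ∑ E i o * E o o * E o i`. Hence the
  -- partition of unity need only sum to one on `Y`.
  have hkill : ∀ h : C(X, ℂ), (∀ x ∈ Y, h x = 0) → ∀ a, ψ (elementaryTensor h 1 * a) = 0 := by
    intro h hh a
    have h1 : h ∈ I := by
      rw [hI, ← ContinuousMap.idealOfSet_ofIdeal_isClosed (isClosed_scalarKernel ψ hEoo),
        ContinuousMap.mem_idealOfSet]
      exact fun x hx => hh x hx
    have h1' : ψ (elementaryTensor h (E o o)) = 0 := h1
    have h2 : elementaryTensor h (1 : M) = ∑ i, elementaryTensor 1 (E i o) *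
        elementaryTensor h (E o o) * elementaryTensor 1 (E o i) := by
      ext x
      simp only [elementaryTensor_mul, ContinuousMap.sum_apply, elementaryTensor_apply, one_mul,
        mul_one, hmul, ← Finset.smul_sum, hsum]
    rw [h2, map_mul, map_sum]
    simp [map_mul, h1']
  obtain ⟨δ, hδ, hGδ⟩ := exists_dist_lt_imp_norm_sub_le G hε
  obtain ⟨S₀, hS₀Y, hS₀fin, hS₀cover⟩ := hYclosed.isCompact.finite_cover_balls hδ
  set S : Finset X := hS₀fin.toFinset with hS
  have hSY : ∀ s ∈ S, s ∈ Y := fun s hs => hS₀Y (hS₀fin.mem_toFinset.1 hs)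
  obtain ⟨ρ, hρ⟩ := PartitionOfUnity.exists_isSubordinate hYclosed
    (fun s : S => Metric.ball (s : X) δ) (fun _ => Metric.isOpen_ball) (by
      intro x hx
      obtain ⟨s, hs, hxs⟩ := Set.mem_iUnion₂.1 (hS₀cover hx)
      exact Set.mem_iUnion.2 ⟨⟨s, hS₀fin.mem_toFinset.2 hs⟩, hxs⟩)
  have hρdist : ∀ (s : S) x, ρ s x ≠ 0 → dist x s < δ := fun s x hx =>
    hρ s (subset_tsupport _ hx)
  have hρ0 : ∀ (s : S) x, 0 ≤ ρ s x := fun s x => ρ.nonneg s x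
  have hρsum : ∀ x ∈ Y, ∑ s, ρ s x = 1 := fun x hx => by
    rw [← finsum_eq_sum_of_fintype]; exact ρ.sum_eq_one hx
  have hρle : ∀ x, ∑ s, ρ s x ≤ 1 := fun x => by
    rw [← finsum_eq_sum_of_fintype]; exact ρ.sum_le_one x
  let R : S → C(X, ℂ) := fun s => ⟨fun x => (ρ s x : ℂ), by fun_prop⟩
  let Q : S → C(X, ℂ) := fun s => ⟨fun x => ((√(ρ s x) : ℝ) : ℂ), by fun_prop⟩
  have hQQ : ∀ s, star (Q s) * Q s = R s := fun s => by
    ext x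
    simp only [Q, R, ContinuousMap.mul_apply, ContinuousMap.star_apply, ContinuousMap.coe_mk,
      RCLike.star_def, Complex.conj_ofReal]
    rw [← Complex.ofReal_mul, Real.mul_self_sqrt (hρ0 s x)]
  -- The square root of `ρ s` makes `star (c κ) * c κ'` equal to `ψ` of `ρ s ⊗ E i j` for two
  -- indices over the same point.
  refine ⟨S, S × ι, inferInstance, inferInstance, Prod.fst,
    fun κ => ψ (elementaryTensor (Q κ.1) (E o κ.2)), fun κ => elementaryTensor 1 (E κ.2 o),
    fun a κ κ' => if κ.1 = κ'.1 then coord (a κ.1) κ.2 κ'.2 else 0, ?_, ?_, ?_⟩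
  · intro a ha
    have h1 : ∑ κ : S × ι, ∑ κ' : S × ι, (if κ.1 = κ'.1 then coord (a κ.1) κ.2 κ'.2 else 0) •
        (star (ψ (elementaryTensor (Q κ.1) (E o κ.2))) * ψ (elementaryTensor (Q κ'.1) (E o κ'.2)))
        = ψ (∑ s, elementaryTensor (R s) (a s)) := by
      rw [map_sum, Fintype.sum_prod_type]
      refine Finset.sum_congr rfl fun s _ => ?_
      have h2 : elementaryTensor (R s) (a s) =
          ∑ i, ∑ j, coord (a s) i j • elementaryTensor (R s) (E i j) := by
        ext x
        simp only [ContinuousMap.sum_apply, ContinuousMap.smul_apply, elementaryTensor_apply]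
        nth_rewrite 1 [← hcoord (a s)]
        simp only [Finset.smul_sum]
        exact Finset.sum_congr rfl fun i _ => Finset.sum_congr rfl fun j _ => smul_comm _ _ _
      rw [h2, map_sum]
      refine Finset.sum_congr rfl fun i _ => ?_
      rw [Fintype.sum_prod_type, Finset.sum_eq_single s, map_sum]
      · refine Finset.sum_congr rfl fun j _ => ?_
        rw [if_pos rfl, map_smul, ← map_star, ← map_mul, star_elementaryTensor,
          elementaryTensor_mul, hstar, hmul, hQQ]
      · intro t _ hts
        refine Finset.sum_eq_zero fun j _ => ?_
        rw [if_neg (Ne.symm hts), zero_smul]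
      · simp
    have h3 : ψ a = ψ (∑ s, elementaryTensor (R s) 1 * a) := by
      have h4 := hkill (1 - ∑ s, R s) (fun x hx => by
        simp only [ContinuousMap.sub_apply, ContinuousMap.one_apply, ContinuousMap.sum_apply, R,
          ContinuousMap.coe_mk]
        rw [← Complex.ofReal_sum, hρsum x hx]; simp) a
      have h5 : elementaryTensor (1 - ∑ s, R s) 1 * a = a - ∑ s, elementaryTensor (R s) 1 * a := by
        ext x
        simp [sub_smul, sub_mul, Finset.sum_smul, Finset.sum_mul]
      rw [h5, map_sub, sub_eq_zero] at h4
      exact h4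
    rw [h1, h3, ← map_sub]
    refine (NonUnitalStarAlgHom.norm_apply_le ψ _).trans ?_
    rw [ContinuousMap.norm_le _ hε.le]
    intro x
    have h6 : (∑ s, elementaryTensor (R s) (a s) - ∑ s, elementaryTensor (R s) 1 * a) x
        = ∑ s, (ρ s x : ℂ) • (a s - a x) := by
      simp [R, smul_sub, Finset.sum_sub_distrib]
    rw [h6]
    calc ‖∑ s, (ρ s x : ℂ) • (a s - a x)‖ ≤ ∑ s, ‖(ρ s x : ℂ) • (a s - a x)‖ := norm_sum_le _ _
      _ ≤ ∑ s, ρ s x * ε := by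
        refine Finset.sum_le_sum fun s _ => ?_
        rw [norm_smul, Complex.norm_real, Real.norm_eq_abs, abs_of_nonneg (hρ0 s x)]
        by_cases h7 : ρ s x = 0
        · rw [h7, zero_mul, zero_mul]
        · refine mul_le_mul_of_nonneg_left (hGδ a ha _ _ ?_) (hρ0 s x)
          rw [dist_comm]; exact hρdist s x h7
      _ = (∑ s, ρ s x) * ε := by rw [Finset.sum_mul]
      _ ≤ ε := by nlinarith [hρle x]
  · intro a κ κ' h
    exact if_neg h
  · intro η hη
    set ω : C(X, M) → S × ι → S × ι → ℂ :=
      fun a κ κ' => if κ.1 = κ'.1 then coord (a κ.1) κ.2 κ'.2 else 0 with hω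
    set Z : C(X, M) → S × ι → S × ι → A := fun a κ κ' =>
      ψ (star (elementaryTensor 1 (E κ.2 o)) * a * elementaryTensor 1 (E κ'.2 o))
        - ω a κ κ' • 1 with hZ
    obtain ⟨W, hW⟩ := Finset.exists_le
      ((G ×ˢ (Finset.univ : Finset ((S × ι) × (S × ι)))).image fun z => ‖Z z.1 z.2.1 z.2.2‖)
    have hW' : ∀ a ∈ G, ∀ κ κ', ‖Z a κ κ'‖ ≤ max W 1 := fun a ha κ κ' =>
      (hW _ (Finset.mem_image.2 ⟨(a, (κ, κ')), by simp [ha], rfl⟩)).trans (le_max_left _ _)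
    set W' := max W 1
    have hW'0 : 0 < W' := lt_max_of_lt_right one_pos
    obtain ⟨δ₁, hδ₁, hG₁⟩ := exists_dist_lt_imp_norm_sub_le G (half_pos hη)
    obtain ⟨δ₂, hδ₂, hS₂⟩ := exists_pos_lt_dist S
    -- Below `δ₁` the elements of `G` vary by at most `η / 2`; below `δ₂` the bumps at distinct
    -- points have product zero. Only the projections depend on `η`, while the points and `ω` stay
    -- fixed.
    set δ' := min δ₁ δ₂ with hδ'
    have hδ'0 : 0 < δ' := lt_min hδ₁ hδ₂
    choose b b' hbstar hbs hbb' hb'1 hb'0 hb0 using fun s : S => exists_bump (s : X) hδ'0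
    set y : S → A := fun s => ψ (elementaryTensor (b s) (E o o)) with hy
    have hy0 : ∀ s, y s ≠ 0 := by
      intro s h
      have h1 : b s ∈ I := h
      have h2 := ContinuousMap.notMem_setOfIdeal.1 (hSY s s.2) h1
      rw [hbs] at h2
      exact one_ne_zero h2
    have hystar : ∀ s, star (y s) = y s := fun s => by
      rw [hy, ← map_star, star_elementaryTensor, hbstar, hstar]
    set g : S → A := fun s => (‖star (y s) * y s‖⁻¹ : ℝ) • (star (y s) * y s) with hg
    have hyn : ∀ s, ‖star (y s) * y s‖ ≠ 0 := fun s => by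
      rw [CStarRing.norm_star_mul_self]
      exact mul_ne_zero (norm_ne_zero_iff.2 (hy0 s)) (norm_ne_zero_iff.2 (hy0 s))
    have hg0 : ∀ s, 0 ≤ g s := fun s =>
      smul_nonneg (inv_nonneg.2 (norm_nonneg _)) (star_mul_self_nonneg _)
    have hg1 : ∀ s, ‖g s‖ = 1 := fun s => by
      rw [hg, norm_smul, norm_inv, norm_norm, inv_mul_cancel₀ (hyn s)]
    have hgr : ∀ s : S, ∃ r : ℝ, g s = r • ψ (elementaryTensor (b s * b s) (E o o)) := fun s =>
      ⟨‖star (y s) * y s‖⁻¹, by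
        simp only [hg]
        rw [hystar, hy, ← map_mul, elementaryTensor_mul, hEoo]⟩
    have hθ : 0 < η / (4 * W') := by positivity
    choose p hp hp0 hpg using fun s => hA.exists_projection_of_norm_eq_one (hg0 s) (hg1 s) hθ
    have hpg' : ∀ s, ‖p s - p s * g s‖ ≤ η / (4 * W') := fun s => by
      rw [← norm_star, star_sub, star_mul, (hp s).isSelfAdjoint.star_eq,
        (IsSelfAdjoint.of_nonneg (hg0 s)).star_eq]
      exact hpg s
    refine ⟨p, fun s => ⟨hp s, hp0 s⟩, fun a ha κ κ' => ?_⟩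
    have h1 : p κ.1 * ψ (star (elementaryTensor 1 (E κ.2 o)) * a * elementaryTensor 1 (E κ'.2 o))
        * p κ'.1 - ω a κ κ' • p κ.1 = p κ.1 * Z a κ κ' * p κ'.1 := by
      have : ω a κ κ' • p κ.1 = p κ.1 * (ω a κ κ' • (1 : A)) * p κ'.1 := by
        rw [mul_smul_comm, smul_mul_assoc, mul_one]
        by_cases hκ : κ.1 = κ'.1
        · rw [← hκ, (hp κ.1).isIdempotentElem.eq]
        · simp only [hω, if_neg hκ, zero_smul]
      rw [this, ← sub_mul, ← mul_sub]
    rw [h1]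
    refine (norm_compression_le (hp _).norm_le (hp _).norm_le (hg1 _).le (hpg' _) (hpg _)).trans ?_
    have h2 : 2 * (η / (4 * W')) * ‖Z a κ κ'‖ ≤ η / 2 := by
      calc 2 * (η / (4 * W')) * ‖Z a κ κ'‖ ≤ 2 * (η / (4 * W')) * W' := by
            gcongr
            exact hW' a ha κ κ'
        _ = η / 2 := by field_simp; norm_num
    suffices h3 : ‖g κ.1 * Z a κ κ' * g κ'.1‖ ≤ η / 2 by linarith
    obtain ⟨s, i⟩ := κ
    obtain ⟨t, j⟩ := κ'
    by_cases hst : s = t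
    · subst hst
      obtain ⟨r, hr⟩ := hgr s
      -- The wider bump `b'` cuts the difference `a - a s` down to where it is small and is
      -- invisible next to `b`. So `‖V‖` alone is the bound, whatever the normalising scalar in `g
      -- s`.
      set V : C(X, M) := elementaryTensor (b' s) 1 * (elementaryTensor 1 (E o i) *
        (a - ContinuousMap.const X (a s)) * elementaryTensor 1 (E j o)) with hV
      have hVn : ‖V‖ ≤ η / 2 := by
        rw [ContinuousMap.norm_le _ (half_pos hη).le]
        intro x
        have h4 : V x = b' s x • (E o i * (a x - a s) * E j o) := by simp [hV]
        rw [h4, norm_smul]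
        by_cases hx : δ' ≤ dist x s
        · rw [hb'0 s x hx, norm_zero, zero_mul]; positivity
        · have h5 := hG₁ a ha x s ((not_le.1 hx).trans_le (min_le_left _ _))
          calc ‖b' s x‖ * ‖E o i * (a x - a s) * E j o‖
              ≤ 1 * (‖E o i‖ * ‖a x - a s‖ * ‖E j o‖) := by
                gcongr
                · exact hb'1 s x
                · exact norm_mul₃_le
            _ ≤ 1 * (1 * (η / 2) * 1) := by
                gcongr
                · exact hEn _ _
                · exact hEn _ _
            _ = η / 2 := by ring
      set T := elementaryTensor (b s * b s) (E o o) with hT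
      have h4 : T * (star (elementaryTensor 1 (E i o)) * a * elementaryTensor 1 (E j o)) * T
          - ω a (s, i) (s, j) • (T * T) = T * V * T := by
        ext x
        have h5 : b' s x * b s x = b s x := by
          rw [← ContinuousMap.mul_apply, hbb']
        simp only [hT, hV, ContinuousMap.sub_apply, ContinuousMap.mul_apply,
          ContinuousMap.smul_apply, elementaryTensor_apply, star_elementaryTensor, star_one,
          ContinuousMap.one_apply, one_smul, one_mul, ContinuousMap.const_apply, hstar, hω,
          if_true, sub_mul, hcompress, smul_mul_assoc, mul_smul_comm, mul_sub,
          hEoo, smul_smul, ← sub_smul]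
        congr 1
        linear_combination (-(coord (a x) i j - coord (a s) i j) * b s x ^ 3) * h5
      have h5 : g s * Z a (s, i) (s, j) * g s = g s * ψ V * g s := by
        rw [hr]
        simp only [hZ, smul_mul_assoc, mul_smul_comm, mul_sub, sub_mul, ← map_mul, mul_one]
        rw [← h4, map_sub, map_smul, smul_comm (ω _ _ _) r, ← smul_sub]
      rw [h5]
      calc ‖g s * ψ V * g s‖ ≤ ‖g s‖ * ‖ψ V‖ * ‖g s‖ := norm_mul₃_le
        _ = ‖ψ V‖ := by rw [hg1]; ring
        _ ≤ η / 2 := (NonUnitalStarAlgHom.norm_apply_le ψ V).trans hVn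
    · have h4 : g s * Z a (s, i) (t, j) * g t = 0 := by
        obtain ⟨r, hr⟩ := hgr s
        obtain ⟨r', hr'⟩ := hgr t
        have h5 : elementaryTensor (b s * b s) (E o o) *
            (star (elementaryTensor 1 (E i o)) * a * elementaryTensor 1 (E j o)) *
            elementaryTensor (b t * b t) (E o o) = 0 := by
          ext x
          have h6 : δ' ≤ dist x s ∨ δ' ≤ dist x t := by
            by_contra! h
            have h7 := hS₂ s s.2 t t.2 (fun h => hst (Subtype.ext h))
            have h8 := dist_triangle_left (s : X) t x
            have h9 : δ' ≤ δ₂ := min_le_right _ _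
            linarith
          rcases h6 with h | h
          · simp [hb0 s x h]
          · simp [hb0 t x h]
        rw [hr, hr']
        simp only [hZ, hω, if_neg hst, zero_smul, sub_zero, smul_mul_assoc, mul_smul_comm,
          ← map_mul, h5, map_zero, smul_zero]
      rw [h4, norm_zero]; positivity

end Block

theorem hasExcision_continuousMap_matrix {A : Type*} [CStarAlgebra A] (hA : HasRealRankZero A)
    {X : Type} [MetricSpace X] [CompactSpace X] {k : ℕ}
    (ψ : C(X, CStarMatrix (Fin k) (Fin k) ℂ) →⋆ₙₐ[ℂ] A)
    (G : Finset C(X, CStarMatrix (Fin k) (Fin k) ℂ)) {ε : ℝ} (hε : 0 < ε) :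
    HasExcision ψ G ε := by
  rcases Nat.eq_zero_or_pos k with rfl | hk
  -- Blocks of size zero are the zero algebra and have no corner index `o`; empty index types serve
  -- for them.
  · refine ⟨Empty, Empty, inferInstance, inferInstance, id, fun κ => κ.elim, fun κ => κ.elim,
      fun _ _ _ => 0, fun a _ => ?_, fun _ _ _ _ => rfl, fun η _ => ⟨fun κ => κ.elim,
        fun κ => κ.elim, fun _ _ κ => κ.elim⟩⟩
    have : a = 0 := by
      ext x i
      exact i.elim0
    simpa [this] using hε.le
  · have hmul : ∀ i j i' j' : Fin k, CStarMatrix.ofMatrix (Matrix.single i j (1 : ℂ)) *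
        CStarMatrix.ofMatrix (Matrix.single i' j' (1 : ℂ)) =
        CStarMatrix.ofMatrix (Matrix.single i j (1 : ℂ) * Matrix.single i' j' (1 : ℂ)) :=
      fun _ _ _ _ => rfl
    refine hasExcision_of_matrixUnits hA ψ (⟨0, hk⟩ : Fin k)
      (fun i j => CStarMatrix.ofMatrix (Matrix.single i j 1)) (fun m i j => m i j)
      (fun i j l => ?_) (fun i j j' l h => ?_) (fun i j => ?_) ?_ (fun m => ?_) G hε
    · rw [hmul, Matrix.single_mul_single_same, one_mul]
    · rw [hmul, Matrix.single_mul_single_of_ne _ _ _ _ h]; rfl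
    · exact congrArg CStarMatrix.ofMatrix
        (show (Matrix.single i j (1 : ℂ)).conjTranspose = Matrix.single j i 1 by
          rw [Matrix.conjTranspose_single, star_one])
    · exact (map_sum (CStarMatrix.ofMatrixₗ (m := Fin k) (n := Fin k) (A := ℂ) (R := ℂ))
        (fun i => Matrix.single i i 1) Finset.univ).symm.trans
        (congrArg CStarMatrix.ofMatrix (Matrix.sum_single_one (α := ℂ)))
    · have h := congrArg (CStarMatrix.ofMatrixₗ (R := ℂ))
        (Matrix.matrix_eq_sum_single (CStarMatrix.ofMatrix.symm m))
      rw [map_sum] at h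
      refine Eq.trans (Finset.sum_congr rfl fun i _ => ?_) h.symm
      rw [map_sum]
      refine Finset.sum_congr rfl fun j _ => ?_
      refine (map_smul (CStarMatrix.ofMatrixₗ (R := ℂ)) (m i j)
        (Matrix.single i j (1 : ℂ))).symm.trans ?_
      rw [Matrix.smul_single, smul_eq_mul, mul_one]
      rfl

/-- The inclusion of a direct summand. -/
noncomputable def summandInclusion {r : ℕ} (C : Fin r → Type) [∀ i, CStarAlgebra (C i)]
    (i : Fin r) : C i →⋆ₙₐ[ℂ] (∀ i, C i) where
  toFun := Pi.single i
  map_smul' c x := Pi.single_smul i c x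
  map_zero' := Pi.single_zero i
  map_add' := Pi.single_add i
  map_mul' := Pi.single_mul i
  map_star' x := by
    ext j
    by_cases h : j = i
    · subst h; simp
    · simp [Pi.single_eq_of_ne h]

/-- Data for the summands are collected over disjoint unions. The cross terms vanish because
different summands multiply to zero. -/
theorem HasExcision.pi {A : Type*} [CStarAlgebra A] {r : ℕ} {C : Fin r → Type}
    [∀ i, CStarAlgebra (C i)]
    (h : ∀ i (ψ : C i →⋆ₙₐ[ℂ] A) (G : Finset (C i)) (ε : ℝ), 0 < ε → HasExcision ψ G ε)
    (ψ : (∀ i, C i) →⋆ₙₐ[ℂ] A) (G : Finset (∀ i, C i)) {ε : ℝ} (hε : 0 < ε) :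
    HasExcision ψ G ε := by
  classical
  have hε' : 0 < ε / (r + 1) := by positivity
  choose M K hM hK ν c d ω h1 h2 h3 using fun i =>
    h i (ψ.comp (summandInclusion C i)) (G.image fun a => a i) (ε / (r + 1)) hε'
  have hmem : ∀ a ∈ G, ∀ i, a i ∈ G.image fun a => a i := fun a ha i =>
    Finset.mem_image_of_mem (fun a : ∀ i, C i => a i) ha
  have hsum : ∀ a : ∀ i, C i, a = ∑ i, summandInclusion C i (a i) := fun a =>
    (Finset.univ_sum_single a).symm
  let Ω : (∀ i, C i) → (Σ i, K i) → (Σ i, K i) → ℂ := fun a κ κ' =>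
    if hκ : κ.1 = κ'.1 then ω κ.1 (a κ.1) κ.2 (hκ ▸ κ'.2) else 0
  have hΩ : ∀ a i κ κ', Ω a ⟨i, κ⟩ ⟨i, κ'⟩ = ω i (a i) κ κ' := fun a i κ κ' => dif_pos rfl
  have hΩ0 : ∀ a i j κ κ', i ≠ j → Ω a ⟨i, κ⟩ ⟨j, κ'⟩ = 0 := fun a i j κ κ' hij => dif_neg hij
  refine ⟨Σ i, M i, Σ i, K i, inferInstance, inferInstance, fun κ => ⟨κ.1, ν κ.1 κ.2⟩,
    fun κ => c κ.1 κ.2, fun κ => summandInclusion C κ.1 (d κ.1 κ.2), Ω, ?_, ?_, ?_⟩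
  · intro a ha
    have h4 : ∑ κ : Σ i, K i, ∑ κ' : Σ i, K i, Ω a κ κ' • (star (c κ.1 κ.2) * c κ'.1 κ'.2) - ψ a
        = ∑ i, (∑ κ, ∑ κ', ω i (a i) κ κ' • (star (c i κ) * c i κ')
          - ψ (summandInclusion C i (a i))) := by
      rw [Finset.sum_sub_distrib, ← map_sum, ← hsum a]
      congr 1
      rw [Fintype.sum_sigma]
      refine Finset.sum_congr rfl fun i _ => Finset.sum_congr rfl fun κ _ => ?_
      rw [Fintype.sum_sigma, Finset.sum_eq_single i]
      · exact Finset.sum_congr rfl fun κ' _ => by rw [hΩ]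
      · intro j _ hj
        exact Finset.sum_eq_zero fun κ' _ => by rw [hΩ0 _ _ _ _ _ hj.symm, zero_smul]
      · simp
    rw [h4]
    calc _ ≤ ∑ i : Fin r, ε / (r + 1) := norm_sum_le_of_le _ fun i _ => h1 i _ (hmem a ha i)
      _ = r * (ε / (r + 1)) := by simp
      _ ≤ ε := by
        rw [mul_div_assoc', div_le_iff₀ (by positivity)]; nlinarith
  · rintro a ⟨i, κ⟩ ⟨j, κ'⟩ hκ
    by_cases hij : i = j
    · subst hij
      rw [hΩ]
      exact h2 i _ _ _ fun h => hκ (by simp [h])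
    · exact hΩ0 _ _ _ _ _ hij
  · intro η hη
    choose p hp hpω using fun i => h3 i η hη
    refine ⟨fun m => p m.1 m.2, fun m => hp m.1 m.2, ?_⟩
    rintro a ha ⟨i, κ⟩ ⟨j, κ'⟩
    by_cases hij : i = j
    · subst hij
      have h4 : star (summandInclusion C i (d i κ)) * a * summandInclusion C i (d i κ')
          = summandInclusion C i (star (d i κ) * a i * d i κ') := by
        rw [← map_star]
        ext j
        by_cases hj : j = i
        · subst hj; simp [summandInclusion]
        · simp [summandInclusion, Pi.single_eq_of_ne hj]
      simp only [hΩ]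
      rw [h4]
      exact hpω i _ (hmem a ha i) κ κ'
    · have h4 : star (summandInclusion C i (d i κ)) * a * summandInclusion C j (d j κ') = 0 := by
        rw [← map_star]
        ext l
        by_cases hl : l = i
        · subst hl; simp [summandInclusion, Pi.single_eq_of_ne hij]
        · simp [summandInclusion, Pi.single_eq_of_ne hl]
      simp only [hΩ0 _ _ _ _ _ hij]
      rw [h4]
      simpa using hη.le

theorem hasExcision_circleAlgebra {A : Type*} [CStarAlgebra A] (hA : HasRealRankZero A) {r : ℕ}
    {k : Fin r → ℕ} (ψ : CircleAlgebra k →⋆ₙₐ[ℂ] A) (G : Finset (CircleAlgebra k)) {ε : ℝ}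
    (hε : 0 < ε) : HasExcision ψ G ε :=
  HasExcision.pi (C := fun i => C(Circle, CStarMatrix (Fin (k i)) (Fin (k i)) ℂ))
    (fun _ ψ G _ hε => hasExcision_continuousMap_matrix hA ψ G hε) ψ G hε

/-! ### Separability and local approximation of AT-algebras -/

instance secondCountableTopology_cstarMatrix (k : ℕ) :
    SecondCountableTopology (CStarMatrix (Fin k) (Fin k) ℂ) := by
  have : FiniteDimensional ℂ (CStarMatrix (Fin k) (Fin k) ℂ) :=
    inferInstanceAs (FiniteDimensional ℂ (Matrix (Fin k) (Fin k) ℂ))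
  have := FiniteDimensional.proper ℂ (CStarMatrix (Fin k) (Fin k) ℂ)
  infer_instance

theorem separableSpace_circleAlgebra {r : ℕ} (k : Fin r → ℕ) :
    TopologicalSpace.SeparableSpace (CircleAlgebra k) := by
  have : TopologicalSpace.SeparableSpace
      (∀ i : Fin r, C(Circle, CStarMatrix (Fin (k i)) (Fin (k i)) ℂ)) := inferInstance
  exact this

theorem IsATAlgebra.separableSpace {A : Type*} [CStarAlgebra A] (hA : IsATAlgebra A) :
    TopologicalSpace.SeparableSpace A := by
  obtain ⟨r, k, φ, ψ, h⟩ := hA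
  have hsep : TopologicalSpace.IsSeparable (⋃ n, Set.range (ψ n)) := by
    refine TopologicalSpace.isSeparable_iUnion.2 fun n => ?_
    have := separableSpace_circleAlgebra (k n)
    exact TopologicalSpace.isSeparable_range
      (NonUnitalStarAlgHom.instContinuousLinearMapClassComplex.map_continuous (ψ n))
  have := hsep.closure
  rw [h.dense_range.closure_eq, TopologicalSpace.isSeparable_univ_iff] at this
  exact this

/-- Finite subsets of a unital AT-algebra are approximately contained in the image of a circle
algebra under a unital homomorphism. -/
theorem IsATAlgebra.exists_approx {A : Type*} [CStarAlgebra A] (hA : IsATAlgebra A)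
    (G : Finset A) {ε : ℝ} (hε : 0 < ε) :
    ∃ (r : ℕ) (k : Fin r → ℕ) (ψ : CircleAlgebra k →⋆ₙₐ[ℂ] A) (b : A → CircleAlgebra k),
      ψ 1 = 1 ∧ ∀ a ∈ G, ‖ψ (b a) - a‖ ≤ ε := by
  obtain ⟨r, k, φ, ψ, h⟩ := hA
  have hmono : Monotone fun n => Set.range (ψ n) := by
    refine monotone_nat_of_le_succ fun n => ?_
    rintro _ ⟨a, rfl⟩
    exact ⟨φ n a, h.compatible n a⟩
  have happrox : ∀ (a : A) (δ : ℝ), 0 < δ →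
      ∀ᶠ n in atTop, ∃ b, ‖ψ n b - a‖ ≤ δ := by
    intro a δ hδ
    obtain ⟨x, hx, hax⟩ := h.dense_range.exists_dist_lt a hδ
    obtain ⟨n, hn⟩ := Set.mem_iUnion.1 hx
    filter_upwards [eventually_ge_atTop n] with m hm
    obtain ⟨b, rfl⟩ := hmono hm hn
    refine ⟨b, ?_⟩
    rw [← dist_eq_norm, dist_comm]
    exact hax.le
  -- Connecting maps need not be unital. But once the image of `ψ n` contains an element within `1 /
  -- 2` of `1`, that element is invertible and fixed by the idempotent `ψ n 1`, which must then be
  -- `1`.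
  obtain ⟨n, ⟨b₁, hb₁⟩, hn⟩ := ((happrox 1 (1 / 2) (by norm_num)).and
    ((Filter.eventually_all_finset G).2 fun a _ => happrox a ε hε)).exists
  choose! b hb using hn
  refine ⟨r n, k n, ψ n, b, ?_, hb⟩
  have hu : IsUnit (ψ n b₁) := by
    have := isUnit_one_sub_of_norm_lt_one (x := 1 - ψ n b₁)
      (by rw [norm_sub_rev]; linarith)
    simpa using this
  refine hu.mul_right_cancel ?_
  rw [← map_mul, one_mul, one_mul]

/-! ### Diagonal sequences -/

/-- At stage `n` one uses a witness for the highest level up to `n` that is solvable there. Each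
fixed level is eventually reached, and higher levels imply lower ones. -/
theorem exists_seq_forall_eventually {X : Type*} [Nonempty X] (P : ℕ → ℕ → X → Prop)
    (hanti : ∀ l n x, P (l + 1) n x → P l n x) (h : ∀ l, ∀ᶠ n in atTop, ∃ x, P l n x) :
    ∃ x : ℕ → X, ∀ l, ∀ᶠ n in atTop, P l n (x n) := by
  classical
  have hmono : ∀ l m n x, l ≤ m → P m n x → P l n x := fun l m n x hlm => by
    induction m, hlm using Nat.le_induction with
    | base => exact id
    | succ m _ ih => exact fun h => ih (hanti m n x h)
  let L : ℕ → ℕ := fun n => Nat.findGreatest (fun l => ∃ x, P l n x) n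
  have hx : ∀ n, ∃ x, (∃ y, P (L n) n y) → P (L n) n x := fun n => by
    by_cases hn : ∃ y, P (L n) n y
    · exact ⟨hn.choose, fun _ => hn.choose_spec⟩
    · exact ⟨Classical.arbitrary X, fun h => absurd h hn⟩
  choose x hx using hx
  refine ⟨x, fun l => ?_⟩
  filter_upwards [h l, eventually_ge_atTop l] with n h1 h2
  exact hmono l (L n) n _ (Nat.le_findGreatest h2 h1)
    (hx n (Nat.findGreatest_spec (P := fun l => ∃ x, P l n x) h2 h1))

theorem tendsto_zero_of_eventually_norm_le {E : Type*} [SeminormedAddCommGroup E] {x : ℕ → E}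
    (l₀ : ℕ) (h : ∀ l ≥ l₀, ∀ᶠ n in atTop, ‖x n‖ ≤ 1 / ((l : ℝ) + 1)) :
    Tendsto x atTop (𝓝 0) := by
  rw [Metric.tendsto_nhds]
  intro ε hε
  obtain ⟨l, hl⟩ := exists_nat_one_div_lt hε
  filter_upwards [h (max l l₀) (le_max_right _ _)] with n hn
  rw [dist_zero_right]
  refine (hn.trans ?_).trans_lt hl
  gcongr
  exact le_max_left _ _

/-! ### The sequence algebra and its relative commutant -/

namespace SequenceAlgebra

variable {B : Type*} [CStarAlgebra B]

theorem seqClass_surjective : Function.Surjective (seqClass : (ℕ →ᵇ B) → SequenceAlgebra B) :=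
  (nullSequences B).ringCon.mk'_surjective

noncomputable instance : StarRing (SequenceAlgebra B) where
  star := star
  star_involutive z := by
    obtain ⟨x, rfl⟩ := seqClass_surjective z
    rw [← seqClass_star, ← seqClass_star, star_star]
  star_mul z z' := by
    obtain ⟨x, rfl⟩ := seqClass_surjective z
    obtain ⟨x', rfl⟩ := seqClass_surjective z'
    rw [← map_mul, ← seqClass_star, ← seqClass_star, ← seqClass_star, star_mul, map_mul]
  star_add z z' := by
    obtain ⟨x, rfl⟩ := seqClass_surjective z
    obtain ⟨x', rfl⟩ := seqClass_surjective z'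
    rw [← map_add, ← seqClass_star, ← seqClass_star, ← seqClass_star, star_add, map_add]

theorem eq_zero_of_star_mul_self {z : SequenceAlgebra B} (h : star z * z = 0) : z = 0 := by
  obtain ⟨x, rfl⟩ := seqClass_surjective z
  rw [← seqClass_star, ← map_mul, ← map_zero seqClass, seqClass_eq_iff] at h
  rw [← map_zero seqClass, seqClass_eq_iff]
  have h1 := h.norm.sqrt
  simp only [BoundedContinuousFunction.coe_mul, Pi.mul_apply, BoundedContinuousFunction.star_apply,
    BoundedContinuousFunction.coe_zero, Pi.zero_apply, sub_zero, CStarRing.norm_star_mul_self,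
    Real.sqrt_mul_self (norm_nonneg _), norm_zero, Real.sqrt_zero] at h1 ⊢
  exact tendsto_zero_iff_norm_tendsto_zero.2 h1

/-- The constant sequences. -/
noncomputable def constClass {A : Type*} [CStarAlgebra A] (ι : A →⋆ₐ[ℂ] B) :
    A →+* SequenceAlgebra B where
  toFun a := seqClass (BoundedContinuousFunction.const ℕ (ι a))
  map_one' := by rw [map_one]; exact map_one seqClass
  map_zero' := by rw [map_zero]; exact map_zero seqClass
  map_add' a b := by rw [map_add ι, ← map_add seqClass]; rfl
  map_mul' a b := by rw [map_mul ι, ← map_mul seqClass]; rfl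

theorem star_constClass {A : Type*} [CStarAlgebra A] (ι : A →⋆ₐ[ℂ] B) (a : A) :
    star (constClass ι a) = constClass ι (star a) := by
  change star (seqClass _) = seqClass _
  rw [← seqClass_star, map_star ι]
  rfl

theorem mem_relativeCommutant_iff {A : Type*} [CStarAlgebra A] (ι : A →⋆ₐ[ℂ] B)
    {z : SequenceAlgebra B} :
    z ∈ relativeCommutant ι ↔ ∀ a, constClass ι a * z = z * constClass ι a := by
  rw [relativeCommutant, Subring.mem_centralizer_iff]
  exact Set.forall_mem_range

theorem mem_relativeCommutant_of_dense {A : Type*} [CStarAlgebra A] (ι : A →⋆ₐ[ℂ] B)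
    {z : SequenceAlgebra B} {S : Set A} (hS : Dense S)
    (h : ∀ a ∈ S, constClass ι a * z = z * constClass ι a) : z ∈ relativeCommutant ι := by
  rw [mem_relativeCommutant_iff]
  intro a
  obtain ⟨x, rfl⟩ := seqClass_surjective z
  have key : ∀ a, constClass ι a * seqClass x = seqClass x * constClass ι a ↔
      Tendsto (fun n => ι a * x n - x n * ι a) atTop (𝓝 0) := fun a => by
    change seqClass _ * seqClass x = seqClass x * seqClass _ ↔ _
    rw [← map_mul, ← map_mul, seqClass_eq_iff]
    rfl
  rw [key, Metric.tendsto_nhds]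
  intro ε hε
  set R := ‖x‖ + 1 with hR
  have hR0 : 0 < R := by positivity
  obtain ⟨b, hb, hab⟩ := hS.exists_dist_lt a (show 0 < ε / (4 * R) by positivity)
  have hb' := (key b).1 (h b hb)
  have hι : ‖ι (a - b)‖ ≤ ε / (4 * R) :=
    (NonUnitalStarAlgHom.norm_apply_le ι _).trans (by rw [← dist_eq_norm]; exact hab.le)
  filter_upwards [(Metric.tendsto_nhds.1 hb') (ε / 2) (by positivity)] with n hn
  rw [dist_zero_right] at hn ⊢
  have hx : ‖x n‖ ≤ R := (x.norm_coe_le_norm n).trans (by linarith)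
  have h1 : ι a * x n - x n * ι a
      = (ι b * x n - x n * ι b) + ι (a - b) * x n - x n * ι (a - b) := by
    rw [map_sub]; noncomm_ring
  have h2 : ‖ι (a - b) * x n‖ ≤ ε / (4 * R) * R := (norm_mul_le _ _).trans (by gcongr)
  have h3 : ‖x n * ι (a - b)‖ ≤ R * (ε / (4 * R)) := (norm_mul_le _ _).trans (by gcongr)
  have h4 : ε / (4 * R) * R = ε / 4 := by field_simp
  rw [h1]
  calc _ ≤ ‖ι b * x n - x n * ι b‖ + ‖ι (a - b) * x n‖ + ‖x n * ι (a - b)‖ :=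
        (norm_sub_le _ _).trans (add_le_add (norm_add_le _ _) le_rfl)
    _ < ε := by linarith

/-- An element intertwining `a` with `a e` approximately for a dense set of elements `a` of `A`
implements property (SI). -/
theorem exists_nilpotent_of_intertwiner {A : Type*} [CStarAlgebra A] (ι : A →⋆ₐ[ℂ] B)
    {E F w : SequenceAlgebra B} (hE : IsStarProjection E) (hEA : E ∈ relativeCommutant ι)
    (hF : IsStarProjection F) {S : Set A} (hS : Dense S)
    (h1 : star w * w = E) (hw : ∀ a ∈ S, star w * constClass ι a * w = constClass ι a * E)
    (hw' : ∀ a ∈ S, star w * constClass ι (star a * a) * w = constClass ι (star a * a) * E)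
    (hFw : F * w = w) (hEw : E * w = 0) :
    w ∈ relativeCommutant ι ∧ star w * w = E ∧ CStarLE (w * star w) F ∧ w ^ 2 = 0 := by
  rw [mem_relativeCommutant_iff] at hEA
  have hEE : E * E = E := hE.isIdempotentElem
  have hsE : star E = E := hE.isSelfAdjoint
  have hFF : F * F = F := hF.isIdempotentElem
  have hsF : star F = F := hF.isSelfAdjoint
  -- The initial projection of `w` is `E`: the square of `w * E - w` expands to zero.
  have hwE : w * E = w := by
    rw [← sub_eq_zero]
    apply eq_zero_of_star_mul_self
    rw [star_sub, star_mul, hsE]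
    have h2 : (E * star w - star w) * (w * E - w)
        = E * (star w * w) * E - E * (star w * w) - star w * w * E + star w * w := by
      noncomm_ring
    rw [h2, h1]
    simp [hEE]
  refine ⟨mem_relativeCommutant_of_dense ι hS fun a ha => ?_, h1, ?_, ?_⟩
  · rw [← sub_eq_zero]
    apply eq_zero_of_star_mul_self
    set α := constClass ι a with hα
    have hsα : star w * star α * w = E * star α := by
      have := congrArg star (hw a ha)
      simp only [star_mul, star_star, hsE, ← mul_assoc] at this
      exact this
    have h2 : star w * (star α * α) * w = star α * α * E := by
      have := hw' a ha
      rwa [map_mul, ← star_constClass] at this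
    rw [star_sub, star_mul, star_mul]
    -- All four terms are covered by the intertwining relations for `1`, `a` and `star a * a`; this
    -- is why products `star a * a` occur in the hypotheses. They cancel because `E` commutes with
    -- `A`.
    have h3 : (star w * star α - star α * star w) * (α * w - w * α)
        = star w * (star α * α) * w - (star w * star α * w) * α - star α * (star w * α * w)
          + star α * (star w * w) * α := by noncomm_ring
    have h4 : star α * E = E * star α := by rw [hα, star_constClass, hEA]
    rw [h3, h2, hsα, hw a ha, h1, ← h4]
    noncomm_ring
  · refine ⟨F - w * star w, ?_⟩
    have hwF : star w * F = star w := by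
      have := congrArg star hFw
      rwa [star_mul, hsF] at this
    have h2 : star (F - w * star w) * (F - w * star w)
        = F * F - (F * w) * star w - w * (star w * F) + w * (star w * w) * star w := by
      rw [star_sub, star_mul, star_star, hsF]; noncomm_ring
    rw [h2, hFF, hFw, hwF, h1, hwE]
    noncomm_ring
  · calc w ^ 2 = w * (E * w) := by rw [sq, ← mul_assoc, hwE]
      _ = 0 := by rw [hEw, mul_zero]

end SequenceAlgebra

/-! ### Intertwiners in the sequence algebra -/

section Intertwiners

open SequenceAlgebra

variable {A : Type u} {B : Type v} [CStarAlgebra A] [CStarAlgebra B]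

/-- One replaces `s` by `p * s`, then `p * y * p'` by `z • p`, then drops `p` again. The last
hypothesis covers both uses: `s = s'` with `star s * s` near `e`, and `z = 0`. -/
theorem norm_star_mul_mul_sub_smul_le {p p' s s' y e : B} {z : ℂ} {θ W : ℝ}
    (hs : ‖s‖ ≤ 1) (hs' : ‖s'‖ ≤ 1) (hp : IsStarProjection p)
    (hps : ‖p * s - s‖ ≤ θ) (hps' : ‖p' * s' - s'‖ ≤ θ) (hy : ‖y‖ ≤ W) (hz : ‖z‖ ≤ W)
    (hW : 1 ≤ W) (hpy : ‖p * y * p' - z • p‖ ≤ θ) (he : ‖z • (star s * s' - e)‖ ≤ W * θ) :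
    ‖star s * y * s' - z • e‖ ≤ 6 * W * θ := by
  have hθ : 0 ≤ θ := (norm_nonneg _).trans hps
  have hsp : star p = p := hp.isSelfAdjoint
  have h1 : star s * y * s' - z • e = star s * (p * y * p' - z • p) * s'
      - star (p * s - s) * y * s' - star (p * s) * y * (p' * s' - s')
      + z • (star (p * s - s) * s') + z • (star s * s' - e) := by
    simp only [star_sub, star_mul, hsp, mul_sub, sub_mul, smul_sub, mul_smul_comm, smul_mul_assoc,
      mul_assoc]
    abel
  have hss : ‖star s‖ ≤ 1 := by rwa [norm_star]
  have h2 : ‖star s * (p * y * p' - z • p) * s'‖ ≤ 1 * θ * 1 := norm_mul₃_le.trans (by gcongr)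
  have h3 : ‖star (p * s - s) * y * s'‖ ≤ θ * W * 1 :=
    norm_mul₃_le.trans (by rw [norm_star]; gcongr)
  have h4 : ‖star (p * s) * y * (p' * s' - s')‖ ≤ (1 * 1) * W * θ := by
    refine norm_mul₃_le.trans ?_
    rw [norm_star]
    gcongr
    exact (norm_mul_le _ _).trans (by gcongr; exact hp.norm_le)
  have h5 : ‖z • (star (p * s - s) * s')‖ ≤ W * (θ * 1) := by
    rw [norm_smul]
    gcongr
    exact (norm_mul_le _ _).trans (by rw [norm_star]; gcongr)
  rw [h1]
  refine (norm_add_le _ _).trans ?_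
  refine (add_le_add ((norm_add_le _ _).trans (add_le_add ((norm_sub_le _ _).trans
    (add_le_add ((norm_sub_le _ _).trans (add_le_add h2 h3)) h4)) h5)) he).trans ?_
  nlinarith

/-- The hypotheses on `e` and `f` in property (SI). -/
structure IsSmallLargePair (ι : A →⋆ₐ[ℂ] B) (e f : ℕ →ᵇ B) : Prop where
  e_selfAdjoint : ∀ n, IsSelfAdjoint (e n)
  f_selfAdjoint : ∀ n, IsSelfAdjoint (f n)
  e_projection : IsStarProjection (seqClass e)
  e_mem : seqClass e ∈ relativeCommutant ι
  f_projection : IsStarProjection (seqClass f)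
  f_mem : seqClass f ∈ relativeCommutant ι
  large : ∃ c : ℝ, 0 < c ∧ ∀ p : A, IsStarProjection p → ∀ ε : ℝ, 0 < ε →
    ∃ N : ℕ, ∀ n, N ≤ n → ∀ τ : TracialState B,
      c * (τ (ι p)).re - ε ≤ (τ (ι p * f n * ι p)).re
  small : ∀ ε : ℝ, 0 < ε → ∃ N : ℕ, ∀ n, N ≤ n → ∀ τ : TracialState B, ‖τ (e n)‖ < ε

theorem IsSmallLargePair.eventually_exists_partial_isometry {ι : A →⋆ₐ[ℂ] B} {e f : ℕ →ᵇ B}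
    (h : IsSmallLargePair ι e f) (hA : IsSimpleCStarAlgebra A) (hB : HasRealRankZero B)
    (hT : ProjectionOrderDeterminedByTraces B) {p : A}
    (hp : IsStarProjection p) (hp0 : p ≠ 0) {η : ℝ} (hη : 0 < η) :
    ∀ᶠ n in atTop, ∃ s : B, ‖s‖ ≤ 1 ∧ ‖star s * s - e n‖ ≤ η ∧ ‖ι p * s - s‖ ≤ η ∧
      ‖f n * s - s‖ ≤ η ∧ ‖e n * s‖ ≤ η := by
  obtain ⟨c, hc, hlarge⟩ := h.large
  refine hA.eventually_exists_partial_isometry hB hT ι hp hp0 e f h.e_selfAdjoint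
    h.f_selfAdjoint ?_ ?_ ?_ hc (hlarge p hp) h.small hη
  · have := h.e_projection.isIdempotentElem
    rw [IsIdempotentElem, ← map_mul, seqClass_eq_iff] at this
    exact this
  · have := h.f_projection.isIdempotentElem
    rw [IsIdempotentElem, ← map_mul, seqClass_eq_iff] at this
    exact this
  · have := (mem_relativeCommutant_iff ι).1 h.f_mem p
    change seqClass _ * seqClass f = seqClass f * seqClass _ at this
    rw [← map_mul, ← map_mul, seqClass_eq_iff] at this
    exact this

/-- Since `ω` does not depend on the precision `η`, letting `η` tend to zero along a diagonal
sequence makes the approximate compressions exact in `B^∞`. -/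
theorem IsSmallLargePair.exists_excising_family {ι : A →⋆ₐ[ℂ] B} {e f : ℕ →ᵇ B}
    (h : IsSmallLargePair ι e f) (hA : IsSimpleCStarAlgebra A) (hB : HasRealRankZero B)
    (hT : ProjectionOrderDeterminedByTraces B) {C : Type} (G : Finset C)
    {M K : Type} [Fintype M] [Fintype K] (ν : K → M) (y : C → K → K → A) (ω : C → K → K → ℂ)
    (hω : ∀ a κ κ', ν κ ≠ ν κ' → ω a κ κ' = 0)
    (hp : ∀ η : ℝ, 0 < η → ∃ p : M → A, (∀ m, IsStarProjection (p m) ∧ p m ≠ 0) ∧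
      ∀ a ∈ G, ∀ κ κ', ‖p (ν κ) * y a κ κ' * p (ν κ') - ω a κ κ' • p (ν κ)‖ ≤ η) :
    ∃ S : M → SequenceAlgebra B, (∀ m, seqClass f * S m = S m) ∧ (∀ m, seqClass e * S m = 0) ∧
      ∀ a ∈ G, ∀ κ κ', star (S (ν κ)) * constClass ι (y a κ κ') * S (ν κ') =
        constClass ι (algebraMap ℂ A (ω a κ κ')) * seqClass e := by
  classical
  obtain ⟨W₀, hW₀⟩ := Finset.exists_le ((G ×ˢ (Finset.univ : Finset (K × K))).image
    fun z => max ‖ι (y z.1 z.2.1 z.2.2)‖ ‖ω z.1 z.2.1 z.2.2‖)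
  set W : ℝ := max W₀ 1
  have hW1 : 1 ≤ W := le_max_right _ _
  have hW : ∀ a ∈ G, ∀ κ κ', max ‖ι (y a κ κ')‖ ‖ω a κ κ'‖ ≤ W := fun a ha κ κ' =>
    (hW₀ _ (Finset.mem_image.2 ⟨(a, (κ, κ')), by simp [ha], rfl⟩)).trans (le_max_left _ _)
  let P : ℕ → ℕ → (M → {s : B // ‖s‖ ≤ 1}) → Prop := fun l n s =>
    (∀ m, ‖f n * s m - s m‖ ≤ 1 / ((l : ℝ) + 1)) ∧ (∀ m, ‖e n * s m‖ ≤ 1 / ((l : ℝ) + 1)) ∧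
    ∀ a ∈ G, ∀ κ κ', ‖star (s (ν κ) : B) * ι (y a κ κ') * s (ν κ') - ω a κ κ' • e n‖
      ≤ 1 / ((l : ℝ) + 1)
  have : Nonempty (M → {s : B // ‖s‖ ≤ 1}) := ⟨fun _ => ⟨0, by simp⟩⟩
  obtain ⟨s, hs⟩ := exists_seq_forall_eventually P
    (fun l n s h => by
      have hl : 1 / (((l + 1 : ℕ) : ℝ) + 1) ≤ 1 / ((l : ℝ) + 1) := by
        gcongr
        simp
      exact ⟨fun m => (h.1 m).trans hl, fun m => (h.2.1 m).trans hl,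
        fun a ha κ κ' => (h.2.2 a ha κ κ').trans hl⟩)
    (fun l => by
      set η : ℝ := 1 / ((l : ℝ) + 1) with hη
      have hη0 : 0 < η := by positivity
      have hθ0 : 0 < η / (6 * W) := by positivity
      have hθη : η / (6 * W) ≤ η := div_le_self hη0.le (by linarith)
      obtain ⟨p, hp, hpy⟩ := hp _ hθ0
      have hev := Filter.eventually_all.2 fun m =>
        h.eventually_exists_partial_isometry hA hB hT (hp m).1 (hp m).2 hθ0
      filter_upwards [hev] with n hn
      choose s hs1 hse hsp hsf hes using hn
      refine ⟨fun m => ⟨s m, hs1 m⟩, fun m => (hsf m).trans hθη, fun m => (hes m).trans hθη,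
        fun a ha κ κ' => ?_⟩
      have h6 : 6 * W * (η / (6 * W)) = η := by field_simp
      rw [← hη, ← h6]
      have hWa := max_le_iff.1 (hW a ha κ κ')
      refine norm_star_mul_mul_sub_smul_le (hs1 _) (hs1 _) ((hp (ν κ)).1.map ι)
        (hsp _) (hsp _) hWa.1 hWa.2 hW1 ?_ ?_
      · rw [← map_smul, ← map_mul, ← map_mul, ← map_sub]
        exact (NonUnitalStarAlgHom.norm_apply_le ι _).trans (hpy a ha κ κ')
      · by_cases hκ : ν κ = ν κ'
        · rw [← hκ, norm_smul]
          exact mul_le_mul hWa.2 (hse _) (norm_nonneg _) (by linarith)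
        · rw [hω a κ κ' hκ, zero_smul, norm_zero]
          positivity)
  let σ : M → ℕ →ᵇ B := fun m => BoundedContinuousFunction.ofNormedAddCommGroup
    (fun n => (s n m : B)) continuous_of_discreteTopology 1 fun n => (s n m).2
  refine ⟨fun m => seqClass (σ m), fun m => ?_, fun m => ?_, fun a ha κ κ' => ?_⟩
  · rw [← map_mul, seqClass_eq_iff]
    exact tendsto_zero_of_eventually_norm_le 0 fun l _ => (hs l).mono fun n hn => hn.1 m
  · rw [← map_mul, ← map_zero seqClass, seqClass_eq_iff]
    refine tendsto_zero_of_eventually_norm_le 0 fun l _ => (hs l).mono fun n hn => ?_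
    rw [BoundedContinuousFunction.coe_zero, Pi.zero_apply, sub_zero]
    exact hn.2.1 m
  · change star (seqClass _) * seqClass _ * seqClass _ = seqClass _ * seqClass e
    rw [← seqClass_star, ← map_mul, ← map_mul, ← map_mul, seqClass_eq_iff]
    refine tendsto_zero_of_eventually_norm_le 0 fun l _ => (hs l).mono fun n hn => ?_
    have := hn.2.2 a ha κ κ'
    have h1 : ω a κ κ' • e n = ι (algebraMap ℂ A (ω a κ κ')) * e n := by
      rw [AlgHomClass.commutes, Algebra.smul_def]
    rw [h1] at this
    exact this

/-- The matrices `ω a` arise by compressing `ψ a` with the `d κ` and the family `S`, and are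
reassembled by the `c κ` into `b a`, close to `ψ a`. The classes of `e` and `f` commute with `A`, so
the relations with them pass from `S` to `w`. -/
theorem IsSmallLargePair.exists_intertwiner_of_hasExcision {ι : A →⋆ₐ[ℂ] B} {e f : ℕ →ᵇ B}
    (h : IsSmallLargePair ι e f) (hA : IsSimpleCStarAlgebra A) (hB : HasRealRankZero B)
    (hT : ProjectionOrderDeterminedByTraces B) {C : Type} [CStarAlgebra C] (ψ : C →⋆ₙₐ[ℂ] A)
    (G : Finset C) {ε : ℝ} (hG : HasExcision ψ G ε) :
    ∃ (w : SequenceAlgebra B) (b : C → A), (∀ a ∈ G, ‖b a - ψ a‖ ≤ ε) ∧ seqClass f * w = w ∧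
      seqClass e * w = 0 ∧
      ∀ a ∈ G, star w * constClass ι (ψ a) * w = constClass ι (b a) * seqClass e := by
  obtain ⟨M, K, hM, hK, ν, c, d, ω, h1, h2, h3⟩ := hG
  obtain ⟨S, hfS, heS, hS⟩ := h.exists_excising_family hA hB hT G ν
    (fun a κ κ' => ψ (star (d κ) * a * d κ')) ω h2 h3
  set γ := constClass ι with hγ
  have hE := (mem_relativeCommutant_iff ι).1 h.e_mem
  have hF := (mem_relativeCommutant_iff ι).1 h.f_mem
  set E := seqClass e
  set F := seqClass f
  refine ⟨∑ κ, γ (ψ (d κ)) * S (ν κ) * γ (c κ),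
    fun a => ∑ κ, ∑ κ', ω a κ κ' • (star (c κ) * c κ'), h1, ?_, ?_, ?_⟩
  · rw [Finset.mul_sum]
    refine Finset.sum_congr rfl fun κ _ => ?_
    rw [← mul_assoc, ← mul_assoc, ← hF, mul_assoc _ F, hfS]
  · rw [Finset.mul_sum]
    refine Finset.sum_eq_zero fun κ _ => ?_
    rw [← mul_assoc, ← mul_assoc, ← hE, mul_assoc _ E, heS, mul_zero, zero_mul]
  · intro a ha
    rw [star_sum, Finset.sum_mul, Finset.sum_mul, map_sum, Finset.sum_mul]
    refine Finset.sum_congr rfl fun κ _ => ?_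
    rw [Finset.mul_sum, map_sum, Finset.sum_mul]
    refine Finset.sum_congr rfl fun κ' _ => ?_
    have h4 := hS a ha κ κ'
    simp only [map_mul, map_star] at h4
    rw [← star_constClass] at h4
    calc star (γ (ψ (d κ)) * S (ν κ) * γ (c κ)) * γ (ψ a) * (γ (ψ (d κ')) * S (ν κ') * γ (c κ'))
        = star (γ (c κ)) * (star (S (ν κ)) * (star (γ (ψ (d κ))) * γ (ψ a) * γ (ψ (d κ')))
            * S (ν κ')) * γ (c κ') := by
          simp only [star_mul, mul_assoc]
      _ = star (γ (c κ)) * γ (algebraMap ℂ A (ω a κ κ')) * (E * γ (c κ')) := by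
          rw [h4]; simp only [mul_assoc]
      _ = γ (ω a κ κ' • (star (c κ) * c κ')) * E := by
          rw [← hE, star_constClass, ← map_mul, ← mul_assoc, ← map_mul, Algebra.smul_def,
            ← mul_assoc, Algebra.commutes]

theorem IsSmallLargePair.eventually_exists_intertwiner {ι : A →⋆ₐ[ℂ] B} {e f : ℕ →ᵇ B}
    (h : IsSmallLargePair ι e f) (hA : IsSimpleCStarAlgebra A) (hAT : IsATAlgebra A)
    (hrr : HasRealRankZero A) (hB : HasRealRankZero B)
    (hT : ProjectionOrderDeterminedByTraces B) (G : Finset A) {ε : ℝ} (hε : 0 < ε) :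
    ∀ᶠ n in atTop, ∃ x : B, ‖x‖ ≤ 2 ∧
      (∀ a ∈ G, ‖star x * ι a * x - ι a * e n‖ ≤ ε) ∧ ‖f n * x - x‖ ≤ ε ∧ ‖e n * x‖ ≤ ε := by
  classical
  -- The four errors at the end are at most `θ`, `4 * θ` and twice `θ * (1 + θ)`, so `8 * θ` in all.
  set θ : ℝ := min (1 / 2) (ε / 9) with hθ
  have hθ0 : 0 < θ := by positivity
  have hθ1 : θ ≤ 1 / 2 := min_le_left _ _
  have hθε : 9 * θ ≤ ε := by
    have : θ ≤ ε / 9 := min_le_right _ _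
    linarith
  obtain ⟨r, k, ψ, β, hψ1, hβ⟩ := hAT.exists_approx G hθ0
  -- Including `1` yields `star x * x ≈ b 1 * e` with `b 1` near `1`. This bounds the norm of `x n`
  -- by `2` independently of `G` and `ε`, as the later diagonal sequence must be bounded.
  obtain ⟨w, b, hb, hfw, hew, hw⟩ := h.exists_intertwiner_of_hasExcision hA hB hT ψ
    (insert 1 (G.image β)) (hasExcision_circleAlgebra hrr ψ _ hθ0)
  obtain ⟨x, rfl⟩ := seqClass_surjective w
  have hee : Tendsto (fun n => e n * e n - e n) atTop (𝓝 0) := by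
    have := h.e_projection.isIdempotentElem
    rw [IsIdempotentElem, ← map_mul, seqClass_eq_iff] at this
    exact this
  have hfx : Tendsto (fun n => f n * x n - x n) atTop (𝓝 0) := by
    rw [← map_mul, seqClass_eq_iff] at hfw
    exact hfw
  have hex : Tendsto (fun n => e n * x n) atTop (𝓝 0) := by
    rw [← map_mul, ← map_zero seqClass, seqClass_eq_iff] at hew
    simpa using hew
  have hxx : ∀ a ∈ insert 1 (G.image β),
      Tendsto (fun n => star (x n) * ι (ψ a) * x n - ι (b a) * e n) atTop (𝓝 0) := by
    intro a ha
    have h1 := hw a ha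
    change star (seqClass _) * seqClass _ * seqClass _ = seqClass _ * seqClass e at h1
    rw [← seqClass_star, ← map_mul, ← map_mul, ← map_mul, seqClass_eq_iff] at h1
    exact h1
  have hlt : ∀ u : ℕ → B, Tendsto u atTop (𝓝 0) → ∀ᶠ n in atTop, ‖u n‖ ≤ θ := fun u hu => by
    have := hu.norm
    rw [norm_zero] at this
    exact (this.eventually_lt_const hθ0).mono fun n hn => hn.le
  filter_upwards [hlt _ hee, hlt _ hfx, hlt _ hex,
    (Filter.eventually_all_finset _).2 fun a ha => hlt _ (hxx a ha)] with n hn1 hn2 hn3 hn4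
  have hιn : ∀ z : A, ‖ι z‖ ≤ ‖z‖ := fun z => NonUnitalStarAlgHom.norm_apply_le ι z
  have hen : ‖e n‖ ≤ 1 + θ := by
    have h1 : ‖e n‖ * ‖e n‖ ≤ ‖e n‖ + θ := by
      rw [← CStarRing.norm_star_mul_self, (h.e_selfAdjoint n).star_eq]
      have := norm_add_le (e n) (e n * e n - e n)
      rw [add_sub_cancel] at this
      linarith
    nlinarith [norm_nonneg (e n)]
  have hb1 : ‖ι (b 1)‖ ≤ 1 + θ := by
    have h1 := hb 1 (Finset.mem_insert_self _ _)
    rw [hψ1] at h1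
    have h2 := norm_add_le (b 1 - 1) 1
    rw [sub_add_cancel] at h2
    have h3 : ‖(1 : A)‖ ≤ 1 := (IsStarProjection.one A).norm_le
    linarith [hιn (b 1)]
  have hxn : ‖x n‖ * ‖x n‖ ≤ 4 := by
    have h1 := hn4 1 (Finset.mem_insert_self _ _)
    rw [hψ1, map_one, mul_one] at h1
    rw [← CStarRing.norm_star_mul_self]
    have h2 := norm_add_le (star (x n) * x n - ι (b 1) * e n) (ι (b 1) * e n)
    rw [sub_add_cancel] at h2
    have h3 : ‖ι (b 1) * e n‖ ≤ (1 + θ) * (1 + θ) := (norm_mul_le _ _).trans (by gcongr)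
    nlinarith
  refine ⟨x n, by nlinarith [norm_nonneg (x n)], fun a ha => ?_, by linarith, by linarith⟩
  have hmem : β a ∈ insert 1 (G.image β) :=
    Finset.mem_insert_of_mem (Finset.mem_image_of_mem β ha)
  have h1 := hn4 (β a) hmem
  have h2 : star (x n) * ι a * x n - ι a * e n
      = (star (x n) * ι (ψ (β a)) * x n - ι (b (β a)) * e n)
        - star (x n) * ι (ψ (β a) - a) * x n + ι (b (β a) - ψ (β a)) * e n
        + ι (ψ (β a) - a) * e n := by
    simp only [map_sub]; noncomm_ring
  have h3 : ‖ι (ψ (β a) - a)‖ ≤ θ := (hιn _).trans (hβ a ha)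
  have h4 : ‖ι (b (β a) - ψ (β a))‖ ≤ θ := (hιn _).trans (hb _ hmem)
  have h5 : ‖star (x n) * ι (ψ (β a) - a) * x n‖ ≤ 4 * θ := by
    refine norm_mul₃_le.trans ?_
    rw [norm_star]
    nlinarith [norm_nonneg (ι (ψ (β a) - a)), norm_nonneg (x n)]
  have h6 : ‖ι (b (β a) - ψ (β a)) * e n‖ ≤ θ * (1 + θ) := (norm_mul_le _ _).trans (by gcongr)
  have h7 : ‖ι (ψ (β a) - a) * e n‖ ≤ θ * (1 + θ) := (norm_mul_le _ _).trans (by gcongr)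
  rw [h2]
  refine (norm_add_le _ _).trans ((add_le_add ((norm_add_le _ _).trans (add_le_add
    ((norm_sub_le _ _).trans (add_le_add h1 h5)) h6)) h7).trans ?_)
  nlinarith

end Intertwiners

/-! ### The conclusion for AT-algebras -/

theorem proposition3p6 (A : Type u) [CStarAlgebra A]
    (hsimple : IsSimpleCStarAlgebra A) (hAT : IsATAlgebra A) (hrr : HasRealRankZero A) :
    HasPropertySI.{u, v} A := by
  classical
  intro B _ hB hT ι _ e f he hf hep hec hfp hfc hlarge hsmall
  have h : IsSmallLargePair ι e f := ⟨he, hf, hep, hec, hfp, hfc, hlarge, hsmall⟩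
  have := hAT.separableSpace
  have := hsimple.1
  let D : ℕ → A := TopologicalSpace.denseSeq A
  let G : ℕ → Finset A := fun l => insert 1 ((Finset.range (l + 1)).biUnion
    fun j => {D j, star (D j) * D j})
  have hG : ∀ l, G l ⊆ G (l + 1) := fun l =>
    Finset.insert_subset_insert _ (Finset.biUnion_subset_biUnion_of_subset_left _
      (Finset.range_mono (Nat.le_succ _)))
  let P : ℕ → ℕ → {x : B // ‖x‖ ≤ 2} → Prop := fun l n x =>
    (∀ a ∈ G l, ‖star (x : B) * ι a * x - ι a * e n‖ ≤ 1 / ((l : ℝ) + 1)) ∧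
      ‖f n * x - x‖ ≤ 1 / ((l : ℝ) + 1) ∧ ‖e n * x‖ ≤ 1 / ((l : ℝ) + 1)
  have : Nonempty {x : B // ‖x‖ ≤ 2} := ⟨⟨0, by simp⟩⟩
  obtain ⟨x, hx⟩ := exists_seq_forall_eventually P
    (fun l n x h => by
      have hl : 1 / (((l + 1 : ℕ) : ℝ) + 1) ≤ 1 / ((l : ℝ) + 1) := by
        gcongr
        simp
      exact ⟨fun a ha => (h.1 a (hG l ha)).trans hl, h.2.1.trans hl, h.2.2.trans hl⟩)
    (fun l => by
      filter_upwards [h.eventually_exists_intertwiner hsimple hAT hrr hB hT (G l)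
        (show (0 : ℝ) < 1 / ((l : ℝ) + 1) by positivity)] with n ⟨x, h1, h2⟩
      exact ⟨⟨x, h1⟩, h2⟩)
  let ξ : ℕ →ᵇ B := BoundedContinuousFunction.ofNormedAddCommGroup
    (fun n => (x n : B)) continuous_of_discreteTopology 2 fun n => (x n).2
  have key : ∀ l, ∀ a ∈ G l, star (seqClass ξ) * SequenceAlgebra.constClass ι a * seqClass ξ
      = SequenceAlgebra.constClass ι a * seqClass e := by
    intro l a ha
    change star (seqClass _) * seqClass _ * seqClass _ = seqClass _ * seqClass e
    rw [← seqClass_star, ← map_mul, ← map_mul, ← map_mul, seqClass_eq_iff]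
    -- An element of `G l` is controlled only from level `l` on, as the sets `G` increase.
    exact tendsto_zero_of_eventually_norm_le l fun m hm => (hx m).mono fun n hn =>
      hn.1 a (monotone_nat_of_le_succ hG hm ha)
  have hmem : ∀ l, D l ∈ G l ∧ star (D l) * D l ∈ G l := fun l => by
    constructor <;>
    exact Finset.mem_insert_of_mem (Finset.mem_biUnion.2 ⟨l, by simp, by simp⟩)
  refine ⟨seqClass ξ, SequenceAlgebra.exists_nilpotent_of_intertwiner ι hep hec hfp
    (TopologicalSpace.denseRange_denseSeq A) ?_ ?_ ?_ ?_ ?_⟩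
  · simpa using key 0 1 (Finset.mem_insert_self _ _)
  · rintro _ ⟨l, rfl⟩
    exact key l _ (hmem l).1
  · rintro _ ⟨l, rfl⟩
    exact key l _ (hmem l).2
  · rw [← map_mul, seqClass_eq_iff]
    exact tendsto_zero_of_eventually_norm_le 0 fun l _ => (hx l).mono fun n hn => hn.2.1
  · rw [← map_mul, ← map_zero seqClass, seqClass_eq_iff]
    refine tendsto_zero_of_eventually_norm_le 0 fun l _ => (hx l).mono fun n hn => ?_
    rw [BoundedContinuousFunction.coe_zero, Pi.zero_apply, sub_zero]
    exact hn.2.2
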